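/- Let $x_1,x_2,\dots$ and $y_1,y_2,\dots$ be independent commuting variables; all identities are in the field of rational functions in them. A \emph{column} is a strictly decreasing (possibly empty) sequence $u=[u_1>u_2>\dots>u_\ell]$ of positive integers, of length $\ell$. A \emph{staircase} is a sequence of columns $t_0,t_1,\dots,t_m$ whose lengths decrease by exactly $1$ at each step and such that, when the columns are drawn side by side with aligned bottoms and $t[i,j]$ denotes the entry of $t_i$ in the $j$-th row from the bottom, $t[i-1,j]\le t[i,j]\le t[i-1,j+1]$ for all $i\ge1$ and all $j\le\ell(t_i)$. The entries of the first column $t_0$ have weight $1$. For $i\ge 1$, the entry $b=t[i,j]$ has weight $\frac{x_i}{y_b}-1$ if $t[i-1,j]=b$, weight $\frac{x_i}{y_b}$ if $t[i-1,j]<b<t[i-1,j+1]$, and weight $1$ otherwise. The weight of a staircase is the product of the weights of its entries, and $F(n,u)$ is the sum of the weights of all staircases with first column $[n,n-1,\dots,1]$ and last column $u$. For a finite set $v$ of positive integers let $\langle v\rangle$ be the sequence whose $b$-th term, $1\le b\le\max v$, is $\#\{a\in v: a>b\}$. For a finite sequence $c$ of nonnegative integers put $y^{c}=\prod_b y_b^{c_b}$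 and $x^c=\prod_i x_i^{c_i}$, and let $\rho_r=[r-1,\dots,1,0]$. For a permutation $\sigma=[\sigma_1,\dots,\sigma_n]$ of $\{1,\dots,n\}$, the double Schubert polynomial $\mathbb X_\sigma(\mathbf x,\mathbf y)$ is determined by $\mathbb X_{[n,\dots,1]}=\prod_{i+j\le n}(x_i-y_j)$ (with $i,j\geq 1$) and $\mathbb X_{\sigma}=\partial_i\mathbb X_{\sigma s_i}$ whenever $\sigma_i<\sigma_{i+1}$, where $\sigma s_i$ is obtained from $\sigma$ by exchanging $\sigma_i$ and $\sigma_{i+1}$, and $\partial_i f=(f-f^{s_i})/(x_i-x_{i+1})$, with $f^{s_i}$ obtained from $f$ by exchanging $x_i$ and $x_{i+1}$. \textbf{Theorem.} Let $n$ be a positive integer, let $0\le r\le n$, and let $u$ be a column of length $n-r$ all of whose entries are at most $n$. Let $\widetilde u$ be the complement of $u$ in $\{1,\dots,n\}$, sorted increasingly, and let $u^\omega=[u_{n-r},\dots,u_1]$ be $u$ reversed. Then $$F(n,u)=x^{\rho_r}\,y^{-\langle\widetilde u\rangle}\,\mathbb X_{\widetilde u,u^\omega}(\mathbf x,\mathbf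 y),$$ where $\widetilde u,u^\omega$ denotes the permutation of $\{1,\dots,n\}$ whose one-line notation is $\widetilde u$ followed by $u^\omega$. In particular, $F(n,u)\,x^{-\rho_r}$ is symmetric in $x_1,\dots,x_r$. -/

import Mathlib

noncomputable section

namespace Staircase

/-! ### The two alphabets -/

/-- Polynomials with integer coefficients in two infinite alphabets `x₁, x₂, …` and `y₁, y₂, …`
(the variables with index `0` are never used). -/
abbrev Poly : Type := MvPolynomial (ℕ ⊕ ℕ) ℤ

/-- Rational functions in the two alphabets. -/
abbrev RatFun : Type := FractionRing Poly

/-- The polynomial variable `x_i`. -/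
def px (i : ℕ) : Poly := MvPolynomial.X (Sum.inl i)

/-- The polynomial variable `y_j`. -/
def py (j : ℕ) : Poly := MvPolynomial.X (Sum.inr j)

/-- `x_i` as a rational function. -/
def x (i : ℕ) : RatFun := algebraMap Poly RatFun (px i)

/-- `y_j` as a rational function. -/
def y (j : ℕ) : RatFun := algebraMap Poly RatFun (py j)

/-- A permutation of the indices of the `x`-variables, acting on polynomials
(the `y`-variables are fixed). -/
def permX (π : Equiv.Perm ℕ) : Poly ≃ₐ[ℤ] Poly :=
  MvPolynomial.renameEquiv ℤ (Equiv.sumCongr π (Equiv.refl ℕ))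

/-- The induced action on rational functions. -/
def permXRat (π : Equiv.Perm ℕ) : RatFun ≃+* RatFun :=
  IsFractionRing.ringEquivOfRingEquiv (permX π).toRingEquiv

/-- `z^c = z₁^{c₁} z₂^{c₂} ⋯` for a finite sequence `c = [c₁, c₂, …]` of exponents. -/
def monom (z : ℕ → RatFun) (c : List ℕ) : RatFun :=
  ∏ k : Fin c.length, z (k + 1) ^ (c.get k)

/-! ### Divided differences and double Schubert polynomials -/

theorem dvd_sub_permX (i : ℕ) (f : Poly) :
    px i - px (i + 1) ∣ f - permX (Equiv.swap i (i + 1)) f := by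
  set I : Ideal Poly := Ideal.span {px i - px (i + 1)} with hI
  have hxy : Ideal.Quotient.mkₐ ℤ I (px i) = Ideal.Quotient.mkₐ ℤ I (px (i + 1)) := by
    rw [Ideal.Quotient.mkₐ_eq_mk, Ideal.Quotient.eq]
    exact Ideal.mem_span_singleton_self _
  have h : Ideal.Quotient.mkₐ ℤ I =
      (Ideal.Quotient.mkₐ ℤ I).comp (permX (Equiv.swap i (i + 1))).toAlgHom := by
    apply MvPolynomial.algHom_ext
    rintro (k | k)
    · have h1 : permX (Equiv.swap i (i + 1)) (MvPolynomial.X (Sum.inl k)) =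
          px (Equiv.swap i (i + 1) k) := MvPolynomial.rename_X _ _
      change Ideal.Quotient.mkₐ ℤ I (px k) =
        Ideal.Quotient.mkₐ ℤ I (permX (Equiv.swap i (i + 1)) (MvPolynomial.X (Sum.inl k)))
      rw [h1]
      by_cases hk : k = i
      · subst hk; rw [Equiv.swap_apply_left]; exact hxy
      by_cases hk' : k = i + 1
      · subst hk'; rw [Equiv.swap_apply_right]; exact hxy.symm
      rw [Equiv.swap_apply_of_ne_of_ne hk hk']
    · have h1 : permX (Equiv.swap i (i + 1)) (MvPolynomial.X (Sum.inr k)) = py k :=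
        MvPolynomial.rename_X _ _
      change Ideal.Quotient.mkₐ ℤ I (py k) =
        Ideal.Quotient.mkₐ ℤ I (permX (Equiv.swap i (i + 1)) (MvPolynomial.X (Sum.inr k)))
      rw [h1]
  rw [← Ideal.mem_span_singleton, ← hI, ← Ideal.Quotient.eq]
  exact DFunLike.congr_fun h f

/-- The Newton divided difference `∂_i f = (f - f^{s_i}) / (x_i - x_{i+1})`: the unique polynomial
`g` with `f - f^{s_i} = (x_i - x_{i+1}) g`. -/
def divDiff (i : ℕ) (f : Poly) : Poly :=
  (dvd_sub_permX i f).choose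

theorem divDiff_spec (i : ℕ) (f : Poly) :
    f - permX (Equiv.swap i (i + 1)) f = (px i - px (i + 1)) * divDiff i f :=
  (dvd_sub_permX i f).choose_spec

/-- The word `σ₁ ⋯ σ_n` of `σ` has an ascent `σ_i < σ_{i+1}` at the (zero-based) position `i`. -/
def IsAscent {n : ℕ} (σ : Equiv.Perm (Fin n)) (i : ℕ) : Prop :=
  ∃ h : i + 1 < n, σ ⟨i, by omega⟩ < σ ⟨i + 1, h⟩

/-- Right multiplication by the simple transposition of the (zero-based) positions `i`, `i + 1`,
i.e. the exchange of two consecutive letters of the word of `σ`. -/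
def swapAt {n : ℕ} (σ : Equiv.Perm (Fin n)) (i : ℕ) (h : i + 1 < n) : Equiv.Perm (Fin n) :=
  σ * Equiv.swap ⟨i, by omega⟩ ⟨i + 1, h⟩

/-- A quantity that drops when an ascent is turned into a descent. -/
def ascMeasure {n : ℕ} (σ : Equiv.Perm (Fin n)) : ℕ :=
  ∑ k : Fin n, (k : ℕ) * (σ k : ℕ)

theorem ascMeasure_swapAt_lt {n : ℕ} (σ : Equiv.Perm (Fin n)) (i : ℕ) (h : i + 1 < n)
    (hlt : σ ⟨i, by omega⟩ < σ ⟨i + 1, h⟩) : ascMeasure (swapAt σ i h) < ascMeasure σ := by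
  set a : Fin n := ⟨i, by omega⟩ with ha
  set b : Fin n := ⟨i + 1, h⟩ with hb
  have hab : b ≠ a := by simp [ha, hb]
  unfold ascMeasure swapAt
  rw [← Finset.add_sum_erase _ _ (Finset.mem_univ a),
    ← Finset.add_sum_erase (a := b) _ _ (by simp [hab]),
    ← Finset.add_sum_erase (Finset.univ) (fun k : Fin n => (k : ℕ) * (σ k : ℕ))
      (Finset.mem_univ a),
    ← Finset.add_sum_erase (a := b) (Finset.univ.erase a) (fun k : Fin n => (k : ℕ) * (σ k : ℕ))
      (by simp [hab])]
  have hrest : ∑ k ∈ (Finset.univ.erase a).erase b, (k : ℕ) * ((σ * Equiv.swap a b) k : ℕ) =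
      ∑ k ∈ (Finset.univ.erase a).erase b, (k : ℕ) * (σ k : ℕ) := by
    apply Finset.sum_congr rfl
    intro k hk
    simp only [Finset.mem_erase, Finset.mem_univ, and_true] at hk
    rw [Equiv.Perm.mul_apply, Equiv.swap_apply_of_ne_of_ne hk.2 hk.1]
  rw [hrest]
  have h3 : (σ * Equiv.swap a b) a = σ b := by simp
  have h4 : (σ * Equiv.swap a b) b = σ a := by simp
  rw [h3, h4]
  have hlt' : (σ a : ℕ) < (σ b : ℕ) := hlt
  have h1 : (a : ℕ) = i := rfl
  have h2 : (b : ℕ) = i + 1 := rfl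
  rw [h1, h2]
  nlinarith

open Classical in
/-- The double Schubert polynomial `𝕏_σ(x, y)` of a permutation `σ` of `{1, …, n}`:
it is the dominant polynomial `∏_{i + j ≤ n} (x_i - y_j)` for the longest permutation
`[n, …, 1]`, the only one without ascent, and `𝕏_σ = ∂_i 𝕏_{σ s_i}` when `σ_i < σ_{i+1}`.
(Divided differences satisfy the braid relations, so the ascent that is used is irrelevant; the
definition takes the first one. Positions are zero-based, variables one-based.) -/
def schubert {n : ℕ} (σ : Equiv.Perm (Fin n)) : Poly :=
  if h : ∃ i, IsAscent σ i then
    divDiff (Nat.find h + 1) (schubert (swapAt σ (Nat.find h) (Nat.find_spec h).1))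
  else
    ∏ i ∈ Finset.Icc 1 n, ∏ j ∈ Finset.Icc 1 (n - i), (px i - py j)
termination_by ascMeasure σ
decreasing_by exact ascMeasure_swapAt_lt σ _ _ (Nat.find_spec h).2

/-- The permutation of `{1, …, n}` with one-line notation `w = [w₁, …, w_n]`
(letters and positions are shifted by one, to `Fin n`). -/
def permOfWord {n : ℕ} (w : List ℕ) (hw : w.Perm (List.range' 1 n)) : Equiv.Perm (Fin n) :=
  have hlen : w.length = n := by simpa using hw.length_eq
  have hmem : ∀ a ∈ w, 1 ≤ a ∧ a < 1 + n := fun a ha => by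
    simpa [List.mem_range'_1] using hw.mem_iff.1 ha
  Equiv.ofBijective
    (fun i : Fin n => ⟨w[(i : ℕ)]'(by omega) - 1, by
      have := hmem _ (List.getElem_mem (l := w) (n := i) (by omega)); omega⟩)
    (Finite.injective_iff_bijective.1 fun i j hij => by
      have hi := hmem _ (List.getElem_mem (l := w) (n := i) (by omega))
      have hj := hmem _ (List.getElem_mem (l := w) (n := j) (by omega))
      have hnd : w.Nodup := hw.nodup_iff.2 List.nodup_range'
      simp only [Fin.mk.injEq] at hij
      exact Fin.ext ((hnd.getElem_inj_iff).1 (by omega)))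

/-! ### Columns and staircases -/

/-- A column: a strictly decreasing sequence of positive integers. -/
def IsColumn (u : List ℕ) : Prop :=
  u.Pairwise (· > ·) ∧ ∀ a ∈ u, 0 < a

/-- The column `v` may stand immediately to the left of the column `u` in a staircase: it is longer
by one and, the bottoms being aligned, rows are weakly increasing and diagonals are weakly
decreasing. As columns are read from top to bottom, the entry with index `k` of `u` has the
entry with index `k + 1` of `v` as its left neighbour, and the one with index `k` of `v` just above
that neighbour. -/
def Adjacent (v u : List ℕ) : Prop :=
  v.length = u.length + 1 ∧
    ∀ k < u.length, v.getD (k + 1) 0 ≤ u.getD k 0 ∧ u.getD k 0 ≤ v.getD k 0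

/-- A staircase, given by the sequence of its columns, from left to right. -/
def IsStaircase (t : List (List ℕ)) : Prop :=
  (∀ c ∈ t, IsColumn c) ∧ t.IsChain Adjacent

/-- The set `ℰ(u, v)` of all staircases with first column `u` and last column `v`. -/
def staircases (u v : List ℕ) : Set (List (List ℕ)) :=
  {t | IsStaircase t ∧ t.head? = some u ∧ t.getLast? = some v}

/-- The product of the weights of the entries of a column `u` whose left neighbour is the
column `v`, with variable `z`. -/
def columnWeight (z : RatFun) (v u : List ℕ) : RatFun :=
  ∏ k ∈ Finset.range u.length,
    if v.getD (k + 1) 0 = u.getD k 0 then z / y (u.getD k 0) - 1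
    else if v.getD (k + 1) 0 < u.getD k 0 ∧ u.getD k 0 < v.getD k 0 then z / y (u.getD k 0)
    else 1

/-- The weight of a staircase. The first column has weight `1`, and the variables `x₁, x₂, …`
belong to the second, third, … column. -/
def weight (t : List (List ℕ)) : RatFun :=
  ∏ i ∈ Finset.range (t.length - 1), columnWeight (x (i + 1)) (t.getD i []) (t.getD (i + 1) [])

theorem finite_adjacent (v : List ℕ) : {u | Adjacent v u}.Finite := by
  apply Set.Finite.subset (s := (fun f : Fin (v.length - 1) → Fin (v.sum + 1) =>
    List.ofFn fun k => (f k : ℕ)) '' Set.univ) (Set.finite_univ.image _)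
  rintro u ⟨hl, hu⟩
  have hb : ∀ k, v.getD k 0 ≤ v.sum := by
    intro k
    by_cases hk : k < v.length
    · rw [List.getD_eq_getElem _ _ hk]
      exact List.le_sum_of_mem (List.getElem_mem hk)
    · rw [List.getD_eq_default _ _ (by omega)]; exact Nat.zero_le _
  refine ⟨fun k => ⟨u.getD k 0, ?_⟩, Set.mem_univ _, ?_⟩
  · have := (hu k (by omega)).2
    have := hb k
    omega
  · apply List.ext_getElem
    · simp; omega
    · intro k h1 h2
      simp [List.getElem?_eq_getElem h2]

/-- There are finitely many staircases with given first column. -/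
theorem finite_chains : ∀ (m : ℕ) (u : List ℕ), u.length = m →
    {t : List (List ℕ) | t.IsChain Adjacent ∧ t.head? = some u}.Finite := by
  intro m
  induction m with
  | zero =>
    intro u hu
    apply (Set.finite_singleton [u]).subset
    rintro t ⟨hc, hh⟩
    match t, hc, hh with
    | [a], _, hh => simpa using hh
    | a :: b :: t, hc, hh =>
      simp only [List.head?_cons, Option.some.injEq] at hh
      have := (List.isChain_cons_cons.1 hc).1.1
      subst hh; omega
  | succ m ih =>
    intro u hu
    have hfin : (⋃ v ∈ {v | Adjacent u v},
        {t : List (List ℕ) | t.IsChain Adjacent ∧ t.head? = some v}).Finite :=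
      (finite_adjacent u).biUnion fun v hv => ih v (by have := hv.1; omega)
    apply ((hfin.image (List.cons u)).union (Set.finite_singleton [u])).subset
    rintro t ⟨hc, hh⟩
    match t, hc, hh with
    | [a], _, hh => right; simpa using hh
    | a :: b :: t, hc, hh =>
      left
      simp only [List.head?_cons, Option.some.injEq] at hh
      subst hh
      have h := List.isChain_cons_cons.1 hc
      refine ⟨b :: t, ?_, rfl⟩
      simp only [Set.mem_iUnion]
      exact ⟨b, h.1, h.2, rfl⟩

theorem finite_staircases (u v : List ℕ) : (staircases u v).Finite :=
  (finite_chains _ u rfl).subset fun _ ht => ⟨ht.1.2, ht.2.1⟩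

/-- The partition function `F(u, v)`: the sum of the weights of all staircases with first
column `u` and last column `v`. -/
def partitionFunction (u v : List ℕ) : RatFun :=
  ∑ t ∈ (finite_staircases u v).toFinset, weight t

/-- The column `[n, …, 1]`. -/
def fullColumn (n : ℕ) : List ℕ := (List.range' 1 n).reverse

/-! ### The data attached to a column -/

/-- The complement of `u` in `{1, …, n}`, sorted increasingly. -/
def complement (n : ℕ) (u : List ℕ) : List ℕ :=
  (List.range' 1 n).filter fun a => decide (a ∉ u)

theorem complement_append_perm {n : ℕ} {u : List ℕ} (hu : IsColumn u) (hn : ∀ a ∈ u, a ≤ n) :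
    (complement n u ++ u.reverse).Perm (List.range' 1 n) := by
  rw [List.perm_ext_iff_of_nodup]
  · intro a
    simp only [complement, List.mem_append, List.mem_filter, List.mem_reverse,
      List.mem_range'_1, decide_eq_true_eq]
    by_cases ha : a ∈ u
    · have := hn a ha
      have := hu.2 a ha
      simp [ha]; omega
    · simp [ha]
  · have hnd : u.Nodup := hu.1.imp fun h => Nat.ne_of_gt h
    refine List.Nodup.append (List.Nodup.filter _ List.nodup_range') (List.nodup_reverse.2 hnd) ?_
    intro a h1 h2
    simp only [complement, List.mem_filter, decide_eq_true_eq] at h1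
    exact h1.2 (List.mem_reverse.1 h2)
  · exact List.nodup_range'

/-- The permutation `[ũ, u^ω]` of `{1, …, n}`: the increasing complement of `u`, followed by the
elements of `u` in increasing order. It is Graßmannian, with descent in `n - ℓ(u)` (or the
identity). -/
def grassmannian {n : ℕ} {u : List ℕ} (hu : IsColumn u) (hn : ∀ a ∈ u, a ≤ n) :
    Equiv.Perm (Fin n) :=
  permOfWord (complement n u ++ u.reverse) (complement_append_perm hu hn)

/-- The sequence `⟨v⟩` of the levels of `1, 2, …, max v`, for a finite set `v` of positive
integers given as a list without repetition. Going down from `max v`, at level `0`, to `1`, one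
passes to a new level after each element of `v`: the level of `b` is the number of
elements of `v` that are larger than `b`. -/
def levels (v : List ℕ) : List ℕ :=
  (List.range' 1 (v.foldr max 0)).map fun b => v.countP fun a => decide (b < a)

/-- `ρ_r = [r-1, …, 1, 0]`. -/
def rho (r : ℕ) : List ℕ := (List.range r).reverse

end Staircase

end

noncomputable section

namespace Staircase

/-! ### Divided differences -/

/-! After multiplication by the Vandermonde product `Δ_r = ∏_{i<j≤r} (x_i - x_j)`, both sides become
the same `r × r` determinant, up to monomials. Write `P_s(w) = ∏_{b<s} (w/y_b - 1)`, and let `S` be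
the complement of `u`.

Staircase side (`partitionFunction_mul_vandermondeProd`): `F(n,u) Δ_r` is `x^{ρ_r}` times the
determinant of the `P_s(x_i)`, with `s ∈ S` and `i ≤ r`. The proof is by induction on `r`, deleting
the last column. The crucial point is that the weighted sum over the left neighbours `v` of `u`
turns the determinants of the complements of `v` into the determinant of `S`, with one more variable
`z` (`sum_adjWeight_mul_det`). To see this, the complement of `v` is read as a word in an exterior
algebra, each letter `s` standing for the vector of values of `P_s`. The sum is computed by raising
the bound on the entries one value at a time (`transfer_eq`): it is a scalar times a product of one
vector `linkVec` for each pair of consecutive elements of `S`. Neighbouring links both involve the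
element of `S` that they share, but its repetition is harmless because squares vanish. Row
operations then recover the larger determinant (`ratPow_mul_det_linkVec`).

Schubert side (`schubert_mul_prod`): a bialternant formula. Sorting the first `r` letters of the
Graßmannian permutation into decreasing order reaches a dominant permutation, whose polynomial is a
product of linear factors. Each step back applies some `∂_i`, and antisymmetrization over `x₁, …,
x_r` does not distinguish `f` from `x_i ∂_i f`. Hence the antisymmetrization of `x^{ρ_r} 𝕏_σ` is
that of the product, a determinant. As `𝕏_σ` is symmetric in these variables, it factors out and
leaves `Δ_r`.

The two determinants differ by the factor `∏_{b<s} y_b` in the row of `s`; together these factors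
form `y^{⟨S⟩}`. -/

theorem permX_px (π : Equiv.Perm ℕ) (i : ℕ) : permX π (px i) = px (π i) :=
  MvPolynomial.rename_X _ _

theorem permX_py (π : Equiv.Perm ℕ) (j : ℕ) : permX π (py j) = py j :=
  MvPolynomial.rename_X _ _

theorem permX_mul (π τ : Equiv.Perm ℕ) (f : Poly) :
    permX (π * τ) f = permX π (permX τ f) := by
  change MvPolynomial.rename _ f = MvPolynomial.rename _ (MvPolynomial.rename _ f)
  rw [MvPolynomial.rename_rename]
  congr 1
  congr 1
  funext k
  rcases k with k | k <;> rfl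

theorem permX_one (f : Poly) : permX 1 f = f := by
  change MvPolynomial.rename _ f = f
  have : (⇑((Equiv.sumCongr (1 : Equiv.Perm ℕ) (Equiv.refl ℕ)))) = id := by
    funext k
    rcases k with k | k <;> rfl
  rw [this, MvPolynomial.rename_id_apply]

theorem px_injective : Function.Injective px := fun _ _ h =>
  Sum.inl_injective (MvPolynomial.X_injective h)

theorem px_sub_px_ne_zero {i j : ℕ} (h : i ≠ j) : px i - px j ≠ 0 :=
  sub_ne_zero.2 (px_injective.ne h)

/-- The quotient is unique because the polynomials form a domain. Identities for `∂_i` are reduced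
through this to identities without denominators. -/
theorem divDiff_eq_of_mul_eq {i : ℕ} {f g : Poly}
    (h : f - permX (Equiv.swap i (i + 1)) f = (px i - px (i + 1)) * g) : divDiff i f = g :=
  mul_left_cancel₀ (px_sub_px_ne_zero (Nat.succ_ne_self i).symm) ((divDiff_spec i f).symm.trans h)

/-- Applying a permutation of the `x`-variables to the defining identity of `∂_i f`. -/
theorem permX_divDiff_spec (π : Equiv.Perm ℕ) (i : ℕ) (f : Poly) :
    permX π f - permX (π * Equiv.swap i (i + 1)) f =
      (px (π i) - px (π (i + 1))) * permX π (divDiff i f) := by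
  have h := congrArg (permX π) (divDiff_spec i f)
  rwa [map_sub, map_mul, map_sub, permX_px, permX_px, ← permX_mul] at h

/-- Numerator and denominator of `∂_i f` both change sign under `s_i`. -/
theorem permX_swap_divDiff (i : ℕ) (f : Poly) :
    permX (Equiv.swap i (i + 1)) (divDiff i f) = divDiff i f := by
  have h := permX_divDiff_spec (Equiv.swap i (i + 1)) i f
  rw [Equiv.swap_mul_self, permX_one, Equiv.swap_apply_left, Equiv.swap_apply_right] at h
  refine (divDiff_eq_of_mul_eq ?_).symm
  linear_combination -h

theorem divDiff_mul_of_symm {i : ℕ} {g : Poly} (hg : permX (Equiv.swap i (i + 1)) g = g)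
    (f : Poly) : divDiff i (g * f) = g * divDiff i f := by
  apply divDiff_eq_of_mul_eq
  rw [map_mul, hg]
  linear_combination g * divDiff_spec i f

/-- With denominators cleared, both sides are `f - s_i f - s_j f + s_i s_j f`. -/
theorem divDiff_comm {i j : ℕ} (hij : i + 1 < j) (f : Poly) :
    divDiff i (divDiff j f) = divDiff j (divDiff i f) := by
  have hc : Equiv.swap i (i + 1) * Equiv.swap j (j + 1) =
      Equiv.swap j (j + 1) * Equiv.swap i (i + 1) := by
    rw [Equiv.mul_swap_eq_swap_mul, Equiv.swap_apply_of_ne_of_ne, Equiv.swap_apply_of_ne_of_ne] <;>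
      omega
  have h1 := permX_divDiff_spec (Equiv.swap i (i + 1)) j f
  have h2 := permX_divDiff_spec (Equiv.swap j (j + 1)) i f
  rw [Equiv.swap_apply_of_ne_of_ne (by omega) (by omega),
    Equiv.swap_apply_of_ne_of_ne (by omega) (by omega)] at h1 h2
  rw [← hc] at h2
  have h3 := divDiff_spec j f
  have h4 := divDiff_spec i f
  have h5 := divDiff_spec j (divDiff i f)
  apply divDiff_eq_of_mul_eq
  apply mul_left_cancel₀ (px_sub_px_ne_zero (Nat.succ_ne_self j).symm)
  linear_combination -h3 + h1 + h4 - h2 + (px i - px (i + 1)) * h5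

/-- With denominators cleared, both sides are the alternating sum of the six images of `f` under the
symmetric group of three consecutive variables. -/
theorem divDiff_braid (i : ℕ) (f : Poly) :
    divDiff i (divDiff (i + 1) (divDiff i f)) =
      divDiff (i + 1) (divDiff i (divDiff (i + 1) f)) := by
  set s := Equiv.swap i (i + 1) with hs
  set t := Equiv.swap (i + 1) (i + 1 + 1) with ht
  have hbraid : s * t * s = t * s * t := by
    ext k
    simp only [hs, ht, Equiv.Perm.mul_apply, Equiv.swap_apply_def]
    split_ifs <;> omega
  have s0 : s i = i + 1 := Equiv.swap_apply_left _ _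
  have s1 : s (i + 1) = i := Equiv.swap_apply_right _ _
  have s2 : s (i + 1 + 1) = i + 1 + 1 :=
    Equiv.swap_apply_of_ne_of_ne (by omega) (by omega)
  have t0 : t i = i := Equiv.swap_apply_of_ne_of_ne (by omega) (by omega)
  have t1 : t (i + 1) = i + 1 + 1 := Equiv.swap_apply_left _ _
  have t2 : t (i + 1 + 1) = i + 1 := Equiv.swap_apply_right _ _
  have ha := px_sub_px_ne_zero (show i ≠ i + 1 by omega)
  have hb := px_sub_px_ne_zero (show i ≠ i + 1 + 1 by omega)
  have hc := px_sub_px_ne_zero (show i + 1 ≠ i + 1 + 1 by omega)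
  apply mul_left_cancel₀ (mul_ne_zero (mul_ne_zero ha hb) hc)
  have e1 := divDiff_spec i (divDiff (i + 1) (divDiff i f))
  have e2 := divDiff_spec (i + 1) (divDiff i f)
  have e3 := divDiff_spec i f
  have e4 := permX_divDiff_spec s (i + 1) (divDiff i f)
  have e5 := permX_divDiff_spec t i f
  have e6 := permX_divDiff_spec (s * t) i f
  have e7 := permX_swap_divDiff i f
  have g1 := divDiff_spec (i + 1) (divDiff i (divDiff (i + 1) f))
  have g2 := divDiff_spec i (divDiff (i + 1) f)
  have g3 := divDiff_spec (i + 1) f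
  have g4 := permX_divDiff_spec t i (divDiff (i + 1) f)
  have g5 := permX_divDiff_spec s (i + 1) f
  have g6 := permX_divDiff_spec (t * s) (i + 1) f
  have g7 := permX_swap_divDiff (i + 1) f
  simp only [← hs, ← ht, Equiv.Perm.mul_apply, s0, s1, s2, t0, t1, t2]
    at e1 e2 e3 e4 e5 e6 e7 g1 g2 g3 g4 g5 g6 g7
  rw [e7] at e4
  rw [g7] at g4
  rw [hbraid] at e6
  have he : (px i - px (i + 1)) * (px i - px (i + 1 + 1)) * (px (i + 1) - px (i + 1 + 1)) *
      divDiff i (divDiff (i + 1) (divDiff i f)) =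
      f - permX s f - permX t f + permX (t * s) f + permX (s * t) f - permX (t * s * t) f := by
    linear_combination -(px i - px (i + 1 + 1)) * (px (i + 1) - px (i + 1 + 1)) * e1
      - (px i - px (i + 1 + 1)) * e2 + (px (i + 1) - px (i + 1 + 1)) * e4 - e3 + e5 - e6
  have hg : (px i - px (i + 1)) * (px i - px (i + 1 + 1)) * (px (i + 1) - px (i + 1 + 1)) *
      divDiff (i + 1) (divDiff i (divDiff (i + 1) f)) =
      f - permX s f - permX t f + permX (t * s) f + permX (s * t) f - permX (t * s * t) f := by
    linear_combination -(px i - px (i + 1 + 1)) * (px i - px (i + 1)) * g1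
      - (px i - px (i + 1 + 1)) * g2 + (px i - px (i + 1)) * g4 - g3 + g5 - g6
  rw [he, hg]

/-! ### Double Schubert polynomials -/

theorem swapAt_left {n : ℕ} (σ : Equiv.Perm (Fin n)) (i : ℕ) (h : i + 1 < n) :
    swapAt σ i h ⟨i, by omega⟩ = σ ⟨i + 1, h⟩ := by
  simp [swapAt]

theorem swapAt_right {n : ℕ} (σ : Equiv.Perm (Fin n)) (i : ℕ) (h : i + 1 < n) :
    swapAt σ i h ⟨i + 1, h⟩ = σ ⟨i, by omega⟩ := by
  simp [swapAt]

theorem swapAt_of_ne {n : ℕ} (σ : Equiv.Perm (Fin n)) (i : ℕ) (h : i + 1 < n) (k : Fin n)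
    (h1 : (k : ℕ) ≠ i) (h2 : (k : ℕ) ≠ i + 1) : swapAt σ i h k = σ k := by
  rw [swapAt, Equiv.Perm.mul_apply, Equiv.swap_apply_of_ne_of_ne] <;>
    (rintro rfl; simp at h1 h2)

theorem swapAt_comm {n : ℕ} (σ : Equiv.Perm (Fin n)) (i j : ℕ) (hi : i + 1 < n) (hj : j + 1 < n)
    (hij : i + 1 < j) : swapAt (swapAt σ i hi) j hj = swapAt (swapAt σ j hj) i hi := by
  rw [swapAt, swapAt, swapAt, swapAt, mul_assoc, mul_assoc, Equiv.mul_swap_eq_swap_mul,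
    Equiv.swap_apply_of_ne_of_ne, Equiv.swap_apply_of_ne_of_ne] <;>
    simp only [ne_eq, Fin.mk.injEq] <;> omega

theorem swapAt_braid {n : ℕ} (σ : Equiv.Perm (Fin n)) (i : ℕ) (h : i + 1 + 1 < n) :
    swapAt (swapAt (swapAt σ i (by omega)) (i + 1) h) i (by omega) =
      swapAt (swapAt (swapAt σ (i + 1) h) i (by omega)) (i + 1) h := by
  have hab : (⟨i, by omega⟩ : Fin n) ≠ ⟨i + 1, by omega⟩ := by simp
  have hac : (⟨i, by omega⟩ : Fin n) ≠ ⟨i + 1 + 1, h⟩ := by simp [Fin.ext_iff]; omega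
  have hbc : (⟨i + 1, by omega⟩ : Fin n) ≠ ⟨i + 1 + 1, h⟩ := by simp
  have key : ∀ a b c : Fin n, a ≠ b → a ≠ c → b ≠ c →
      Equiv.swap a b * (Equiv.swap b c * Equiv.swap a b) =
        Equiv.swap b c * (Equiv.swap a b * Equiv.swap b c) := by
    intro a b c hab hac hbc
    rw [← mul_assoc, ← mul_assoc, Equiv.swap_mul_swap_mul_swap hab hac, Equiv.swap_comm a b,
      Equiv.swap_comm b c, Equiv.swap_mul_swap_mul_swap hbc.symm hac.symm, Equiv.swap_comm]
  simp only [swapAt, mul_assoc]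
  rw [key _ _ _ hab hac hbc]

open Classical in
theorem schubert_of_exists {n : ℕ} (σ : Equiv.Perm (Fin n)) (h : ∃ i, IsAscent σ i) :
    schubert σ =
      divDiff (Nat.find h + 1) (schubert (swapAt σ (Nat.find h) (Nat.find_spec h).1)) := by
  rw [schubert, dif_pos h]

theorem schubert_of_not_exists {n : ℕ} (σ : Equiv.Perm (Fin n)) (h : ¬ ∃ i, IsAscent σ i) :
    schubert σ = ∏ i ∈ Finset.Icc 1 n, ∏ j ∈ Finset.Icc 1 (n - i), (px i - py j) := by
  rw [schubert, dif_neg h]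

/-- If `σ` has an ascent in position `i`, and the first one is `j`, one recursion step leads to
`j`. -/
theorem exists_first_ascent {n : ℕ} (σ : Equiv.Perm (Fin n)) (h : ∃ i, IsAscent σ i) :
    ∃ (j : ℕ) (hj : j + 1 < n), σ ⟨j, by omega⟩ < σ ⟨j + 1, hj⟩ ∧
      (∀ i, IsAscent σ i → j ≤ i) ∧ schubert σ = divDiff (j + 1) (schubert (swapAt σ j hj)) := by
  classical
  refine ⟨Nat.find h, (Nat.find_spec h).1, (Nat.find_spec h).2, fun i hi => Nat.find_le hi, ?_⟩
  convert schubert_of_exists σ h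

/-- Any ascent can be used in the recursion for double Schubert polynomials. -/
theorem schubert_eq_divDiff {n : ℕ} (σ : Equiv.Perm (Fin n)) (i : ℕ) (hi : i + 1 < n)
    (hlt : σ ⟨i, by omega⟩ < σ ⟨i + 1, hi⟩) :
    schubert σ = divDiff (i + 1) (schubert (swapAt σ i hi)) := by
  induction hm : ascMeasure σ using Nat.strong_induction_on generalizing σ i with
  | _ m ih =>
  subst hm
  obtain ⟨j, hj, hjlt, hmin, hS⟩ := exists_first_ascent σ ⟨i, hi, hlt⟩
  have hji := hmin i ⟨hi, hlt⟩
  have hmj := ascMeasure_swapAt_lt σ j hj hjlt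
  have hmi := ascMeasure_swapAt_lt σ i hi hlt
  -- The ascent `i` and the first ascent `j` are far apart (commutation), or neighbours, so that
  -- three consecutive letters increase (braid relation), or equal.
  rcases Nat.lt_or_ge (j + 1) i with h1 | h1
  · have hi' : swapAt σ j hj ⟨i, by omega⟩ < swapAt σ j hj ⟨i + 1, hi⟩ := by
      rw [swapAt_of_ne, swapAt_of_ne] <;> first | exact hlt | (simp only []; omega)
    have hj' : swapAt σ i hi ⟨j, by omega⟩ < swapAt σ i hi ⟨j + 1, hj⟩ := by
      rw [swapAt_of_ne, swapAt_of_ne] <;> first | exact hjlt | (simp only []; omega)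
    rw [hS, ih _ hmj _ i hi hi' rfl, ih _ hmi _ j hj hj' rfl, swapAt_comm σ j i hj hi h1]
    exact divDiff_comm (by omega) _
  rcases Nat.lt_or_ge j i with h2 | h2
  · obtain rfl : i = j + 1 := by omega
    have h0 : swapAt σ j hj ⟨j + 1, hj⟩ < swapAt σ j hj ⟨j + 1 + 1, hi⟩ := by
      rw [swapAt_right, swapAt_of_ne] <;> first | exact hjlt.trans hlt | (simp only []; omega)
    have m0 := ascMeasure_swapAt_lt _ _ hi h0
    have h0' : swapAt (swapAt σ j hj) (j + 1) hi ⟨j, by omega⟩ <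
        swapAt (swapAt σ j hj) (j + 1) hi ⟨j + 1, hj⟩ := by
      rw [swapAt_left, swapAt_of_ne, swapAt_left, swapAt_of_ne] <;>
        first | exact hlt | (simp only []; omega)
    have h3 : swapAt σ (j + 1) hi ⟨j, by omega⟩ < swapAt σ (j + 1) hi ⟨j + 1, hj⟩ := by
      rw [swapAt_left, swapAt_of_ne] <;> first | exact hjlt.trans hlt | (simp only []; omega)
    have m3 := ascMeasure_swapAt_lt _ _ hj h3
    have h3' : swapAt (swapAt σ (j + 1) hi) j hj ⟨j + 1, hj⟩ <
        swapAt (swapAt σ (j + 1) hi) j hj ⟨j + 1 + 1, hi⟩ := by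
      rw [swapAt_right, swapAt_of_ne, swapAt_of_ne, swapAt_right] <;>
        first | exact hjlt | (simp only []; omega)
    rw [hS, ih _ hmj _ (j + 1) hi h0 rfl, ih _ (m0.trans hmj) _ j hj h0' rfl,
      ih _ hmi _ j hj h3 rfl, ih _ (m3.trans hmi) _ (j + 1) hi h3' rfl, swapAt_braid σ j hi]
    exact divDiff_braid _ _
  · obtain rfl : i = j := by omega
    exact hS

theorem permX_swap_schubert {n : ℕ} (σ : Equiv.Perm (Fin n)) (i : ℕ) (hi : i + 1 < n)
    (hlt : σ ⟨i, by omega⟩ < σ ⟨i + 1, hi⟩) :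
    permX (Equiv.swap (i + 1) (i + 1 + 1)) (schubert σ) = schubert σ := by
  rw [schubert_eq_divDiff σ i hi hlt, permX_swap_divDiff]

/-! ### Codes and dominant permutations -/

/-- The code of the first `r` letters of `σ`: the number of smaller letters between the position `i`
and the position `r`. -/
def code {n : ℕ} (r : ℕ) (σ : Equiv.Perm (Fin n)) (i : Fin n) : ℕ :=
  (Finset.univ.filter fun j : Fin n => i < j ∧ (j : ℕ) < r ∧ σ j < σ i).card

/-- The larger letter moves left past the smaller one, and so counts it in addition. -/
theorem code_swapAt_left {n r : ℕ} (σ : Equiv.Perm (Fin n)) (i : ℕ) (hi : i + 1 < n)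
    (hr : i + 1 < r) (hlt : σ ⟨i, by omega⟩ < σ ⟨i + 1, hi⟩) :
    code r (swapAt σ i hi) ⟨i, by omega⟩ = code r σ ⟨i + 1, hi⟩ + 1 := by
  rw [code, code, ← Finset.card_insert_of_notMem (a := (⟨i + 1, hi⟩ : Fin n)) (by simp)]
  congr 1
  ext j
  simp only [Finset.mem_filter, Finset.mem_univ, true_and, Finset.mem_insert, swapAt_left]
  by_cases h1 : j = ⟨i + 1, hi⟩
  · subst h1
    simp only [swapAt_right, true_or, iff_true]
    exact ⟨by simp, hr, hlt⟩
  have h1' : (j : ℕ) ≠ i + 1 := fun h => h1 (Fin.ext h)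
  by_cases h2 : (j : ℕ) = i
  · have h3 : ¬ (⟨i, by omega⟩ : Fin n) < j := fun h => (show i < (j : ℕ) from h).ne h2.symm
    have h4 : ¬ (⟨i + 1, hi⟩ : Fin n) < j := fun h => by
      have : i + 1 < (j : ℕ) := h
      omega
    simp [h1, h3, h4]
  · rw [swapAt_of_ne σ i hi j h2 h1']
    simp only [h1, false_or, Fin.lt_def]
    refine and_congr_left fun _ => ?_
    omega

/-- The smaller letter moves right past a larger one, which it never counted. -/
theorem code_swapAt_right {n r : ℕ} (σ : Equiv.Perm (Fin n)) (i : ℕ) (hi : i + 1 < n)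
    (hlt : σ ⟨i, by omega⟩ < σ ⟨i + 1, hi⟩) :
    code r (swapAt σ i hi) ⟨i + 1, hi⟩ = code r σ ⟨i, by omega⟩ := by
  rw [code, code]
  congr 1
  ext j
  simp only [Finset.mem_filter, Finset.mem_univ, true_and, swapAt_right]
  by_cases h1 : j = ⟨i + 1, hi⟩
  · subst h1
    simp [hlt.le]
  have h1' : (j : ℕ) ≠ i + 1 := fun h => h1 (Fin.ext h)
  by_cases h2 : (j : ℕ) = i
  · have h3 : ¬ (⟨i, by omega⟩ : Fin n) < j := fun h => (show i < (j : ℕ) from h).ne h2.symm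
    have h4 : ¬ (⟨i + 1, hi⟩ : Fin n) < j := fun h => by
      have : i + 1 < (j : ℕ) := h
      omega
    simp [h3, h4]
  · rw [swapAt_of_ne σ i hi j h2 h1']
    simp only [Fin.lt_def]
    refine and_congr_left fun _ => ?_
    omega

theorem code_swapAt_of_ne {n r : ℕ} (σ : Equiv.Perm (Fin n)) (i : ℕ) (hi : i + 1 < n)
    (hr : i + 1 < r) (k : Fin n) (h1 : (k : ℕ) ≠ i) (h2 : (k : ℕ) ≠ i + 1) :
    code r (swapAt σ i hi) k = code r σ k := by
  rw [code, code]
  refine Finset.card_equiv (Equiv.swap ⟨i, by omega⟩ ⟨i + 1, hi⟩) fun j => ?_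
  simp only [Finset.mem_filter, Finset.mem_univ, true_and, swapAt_of_ne σ i hi k h1 h2]
  rw [← and_assoc, ← and_assoc]
  refine and_congr ?_ Iff.rfl
  rw [Equiv.swap_apply_def]
  split_ifs with h3 h4
  · subst h3
    simp only [Fin.lt_def]
    omega
  · subst h4
    simp only [Fin.lt_def]
    omega
  · rfl

theorem code_le_of_lt {n r : ℕ} (σ : Equiv.Perm (Fin n)) (i : ℕ) (hi : i + 1 < n)
    (hlt : σ ⟨i, by omega⟩ < σ ⟨i + 1, hi⟩) :
    code r σ ⟨i, by omega⟩ ≤ code r σ ⟨i + 1, hi⟩ := by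
  refine Finset.card_le_card fun j => ?_
  simp only [Finset.mem_filter, Finset.mem_univ, true_and]
  rintro ⟨h1, h2, h3⟩
  refine ⟨?_, h2, h3.trans hlt⟩
  rcases eq_or_ne j ⟨i + 1, hi⟩ with rfl | hj
  · exact absurd h3 hlt.not_gt
  · have : (j : ℕ) ≠ i + 1 := fun h => hj (Fin.ext h)
    simp only [Fin.lt_def] at h1 ⊢
    omega

theorem code_lt_of_gt {n r : ℕ} (σ : Equiv.Perm (Fin n)) (i : ℕ) (hi : i + 1 < n)
    (hr : i + 1 < r) (hlt : σ ⟨i + 1, hi⟩ < σ ⟨i, by omega⟩) :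
    code r σ ⟨i + 1, hi⟩ + 1 ≤ code r σ ⟨i, by omega⟩ := by
  rw [code, code, ← Finset.card_insert_of_notMem (a := (⟨i + 1, hi⟩ : Fin n)) (by simp)]
  refine Finset.card_le_card fun j => ?_
  simp only [Finset.mem_filter, Finset.mem_univ, true_and, Finset.mem_insert]
  rintro (rfl | ⟨h1, h2, h3⟩)
  · exact ⟨by simp, hr, hlt⟩
  · refine ⟨?_, h2, h3.trans hlt⟩
    simp only [Fin.lt_def] at h1 ⊢
    omega

theorem code_le {n r : ℕ} (σ : Equiv.Perm (Fin n)) (i : Fin n) : code r σ i ≤ r - (i + 1) := by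
  have h : ((Finset.univ.filter fun j : Fin n => i < j ∧ (j : ℕ) < r ∧ σ j < σ i).map
      Fin.valEmbedding) ⊆ Finset.Ico ((i : ℕ) + 1) r := by
    intro a
    simp only [Finset.mem_map, Finset.mem_filter, Finset.mem_univ, true_and, Finset.mem_Ico,
      Fin.valEmbedding_apply]
    rintro ⟨j, ⟨h1, h2, -⟩, rfl⟩
    exact ⟨h1, h2⟩
  simpa [code] using Finset.card_le_card h

/-- The code of the first `r` letters is weakly decreasing. For `r = n`, this says that `σ` is
dominant. -/
def IsDominant {n : ℕ} (r : ℕ) (σ : Equiv.Perm (Fin n)) : Prop :=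
  ∀ (k : ℕ) (hk : k + 1 < n), k + 1 < r → code r σ ⟨k + 1, hk⟩ ≤ code r σ ⟨k, by omega⟩

/-- At an ascent the code can only grow weakly, by transitivity of `<`; dominance gives the opposite
inequality. -/
theorem IsDominant.code_eq {n r : ℕ} {σ : Equiv.Perm (Fin n)} (h : IsDominant r σ) (i : ℕ)
    (hi : i + 1 < n) (hr : i + 1 < r) (hlt : σ ⟨i, by omega⟩ < σ ⟨i + 1, hi⟩) :
    code r σ ⟨i, by omega⟩ = code r σ ⟨i + 1, hi⟩ :=
  (code_le_of_lt σ i hi hlt).antisymm (h i hi hr)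

theorem gt_of_not_isAscent {n : ℕ} {σ : Equiv.Perm (Fin n)} {i : ℕ} (hi : i + 1 < n)
    (h : ¬ IsAscent σ i) : σ ⟨i + 1, hi⟩ < σ ⟨i, by omega⟩ :=
  lt_of_le_of_ne (not_lt.1 fun h' => h ⟨hi, h'⟩) (σ.injective.ne (by simp))

/-- Exchanging the letters of the first ascent preserves dominance. -/
theorem IsDominant.swapAt {n r : ℕ} {σ : Equiv.Perm (Fin n)} (h : IsDominant r σ) (i : ℕ)
    (hi : i + 1 < n) (hr : i + 1 < r) (hlt : σ ⟨i, by omega⟩ < σ ⟨i + 1, hi⟩)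
    (hmin : ∀ j, IsAscent σ j → i ≤ j) : IsDominant r (swapAt σ i hi) := by
  have he := h.code_eq i hi hr hlt
  intro k hk hkr
  have hk' := h k hk hkr
  rcases lt_trichotomy k i with h1 | rfl | h1
  · rcases Nat.lt_or_ge (k + 1) i with h2 | h2
    · rw [code_swapAt_of_ne, code_swapAt_of_ne] <;> first | exact hk' | omega | (simp only []; omega)
    · obtain rfl : i = k + 1 := by omega
      -- A position before the first ascent is a descent, where the code drops strictly. This leaves
      -- room for the code at `k + 1` to increase by one.
      have := code_lt_of_gt σ k hk hkr (gt_of_not_isAscent hk fun h' => by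
        have := hmin _ h'; omega)
      rw [code_swapAt_left _ _ _ hr hlt, code_swapAt_of_ne _ _ _ hr] <;>
        first | omega | (simp only []; omega)
  · rw [code_swapAt_left _ _ _ hr hlt, code_swapAt_right _ _ _ hlt]
    omega
  · rcases Nat.lt_or_ge (i + 1) k with h2 | h2
    · rw [code_swapAt_of_ne, code_swapAt_of_ne] <;> first | exact hk' | omega | (simp only []; omega)
    · obtain rfl : k = i + 1 := by omega
      rw [code_swapAt_right _ _ _ hlt, code_swapAt_of_ne _ _ _ hr] <;>
        first | omega | (simp only []; omega)

/-- `(x_i - y_1) ⋯ (x_i - y_m)`. -/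
def shiftedPow (i m : ℕ) : Poly := ∏ j ∈ Finset.Icc 1 m, (px i - py j)

theorem shiftedPow_succ (i m : ℕ) :
    shiftedPow i (m + 1) = shiftedPow i m * (px i - py (m + 1)) :=
  Finset.prod_Icc_succ_top (by omega) _

theorem permX_shiftedPow (π : Equiv.Perm ℕ) (i m : ℕ) :
    permX π (shiftedPow i m) = shiftedPow (π i) m := by
  simp only [shiftedPow, map_prod, map_sub, permX_px, permX_py]

theorem divDiff_px_sub_py (i j : ℕ) : divDiff i (px i - py j) = 1 := by
  apply divDiff_eq_of_mul_eq
  rw [map_sub, permX_px, permX_py, Equiv.swap_apply_left]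
  ring

theorem gt_of_forall_succ_lt {n r : ℕ} (σ : Equiv.Perm (Fin n))
    (h : ∀ (k : ℕ) (hk : k + 1 < n), k + 1 < r → σ ⟨k + 1, hk⟩ < σ ⟨k, by omega⟩)
    {i j : Fin n} (hij : i < j) (hj : (j : ℕ) < r) : σ j < σ i := by
  obtain ⟨i, hi⟩ := i
  obtain ⟨j, hj'⟩ := j
  simp only [Fin.mk_lt_mk] at hij hj
  induction j with
  | zero => omega
  | succ j ih =>
    have h1 := h j hj' hj
    rcases Nat.lt_or_ge i j with h2 | h2
    · exact h1.trans (ih (by omega) (by omega) h2)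
    · obtain rfl : i = j := by omega
      exact h1

theorem prod_fin_split {n : ℕ} {M : Type*} [CommMonoid M] (f : Fin n → M) (i : ℕ)
    (hi : i + 1 < n) : ∏ k, f k = f ⟨i, by omega⟩ * (f ⟨i + 1, hi⟩ *
      ∏ k ∈ (Finset.univ.erase (⟨i, by omega⟩ : Fin n)).erase ⟨i + 1, hi⟩, f k) := by
  rw [Finset.mul_prod_erase _ f (by simp), Finset.mul_prod_erase _ f (by simp)]

theorem ne_of_mem_erase_erase {n i : ℕ} {hi : i + 1 < n} {k : Fin n}
    (hk : k ∈ (Finset.univ.erase (⟨i, by omega⟩ : Fin n)).erase ⟨i + 1, hi⟩) :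
    (k : ℕ) ≠ i ∧ (k : ℕ) ≠ i + 1 := by
  simpa [Fin.ext_iff, and_comm] using hk

/-- The double Schubert polynomial of a dominant permutation is a product. -/
theorem schubert_of_isDominant {n : ℕ} (σ : Equiv.Perm (Fin n)) (h : IsDominant n σ) :
    schubert σ = ∏ k : Fin n, shiftedPow (k + 1) (code n σ k) := by
  induction hm : ascMeasure σ using Nat.strong_induction_on generalizing σ with
  | _ m ih =>
  subst hm
  by_cases hex : ∃ i, IsAscent σ i
  · obtain ⟨i, hi, hlt, hmin, hS⟩ := exists_first_ascent σ hex
    have he := h.code_eq i hi hi hlt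
    rw [hS, ih _ (ascMeasure_swapAt_lt σ i hi hlt) _ (h.swapAt i hi hi hlt hmin) rfl,
      prod_fin_split _ i hi, prod_fin_split _ i hi, code_swapAt_left _ _ _ hi hlt,
      code_swapAt_right _ _ _ hlt, he, shiftedPow_succ]
    have hR : ∏ k ∈ (Finset.univ.erase (⟨i, by omega⟩ : Fin n)).erase ⟨i + 1, hi⟩,
        shiftedPow (k + 1) (code n (Staircase.swapAt σ i hi) k) =
        ∏ k ∈ (Finset.univ.erase (⟨i, by omega⟩ : Fin n)).erase ⟨i + 1, hi⟩,
        shiftedPow (k + 1) (code n σ k) := Finset.prod_congr rfl fun k hk => by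
      obtain ⟨h1, h2⟩ := ne_of_mem_erase_erase hk
      rw [code_swapAt_of_ne _ _ _ hi _ h1 h2]
    rw [hR]
    set R := ∏ k ∈ (Finset.univ.erase (⟨i, by omega⟩ : Fin n)).erase ⟨i + 1, hi⟩,
        shiftedPow (k + 1) (code n σ k) with hRdef
    have hRs : permX (Equiv.swap (i + 1) (i + 1 + 1)) R = R := by
      rw [hRdef, map_prod]
      refine Finset.prod_congr rfl fun k hk => ?_
      obtain ⟨h1, h2⟩ := ne_of_mem_erase_erase hk
      rw [permX_shiftedPow, Equiv.swap_apply_of_ne_of_ne] <;> omega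
    set c := code n σ ⟨i + 1, hi⟩
    have hM : permX (Equiv.swap (i + 1) (i + 1 + 1))
        (shiftedPow (i + 1) c * (shiftedPow (i + 1 + 1) c * R)) =
          shiftedPow (i + 1) c * (shiftedPow (i + 1 + 1) c * R) := by
      rw [map_mul, map_mul, hRs, permX_shiftedPow, permX_shiftedPow, Equiv.swap_apply_left,
        Equiv.swap_apply_right]
      ring
    -- The two variables occur with exponents `c + 1` and `c`. Setting aside the last linear factor
    -- leaves a symmetric polynomial, and `∂` sends that factor to `1`.
    rw [show shiftedPow (i + 1) c * (px (i + 1) - py (c + 1)) * (shiftedPow (i + 1 + 1) c * R) =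
      shiftedPow (i + 1) c * (shiftedPow (i + 1 + 1) c * R) * (px (i + 1) - py (c + 1)) by ring,
      divDiff_mul_of_symm hM, divDiff_px_sub_py, mul_one]
  · rw [schubert_of_not_exists σ hex]
    have hanti : ∀ {i j : Fin n}, i < j → σ j < σ i := fun {i j} hij =>
      gt_of_forall_succ_lt (r := n) σ
        (fun k hk _ => gt_of_not_isAscent hk fun h' => hex ⟨k, h'⟩) hij j.2
    have hcode : ∀ k : Fin n, code n σ k = n - (k + 1) := by
      intro k
      have : (Finset.univ.filter fun j : Fin n => k < j ∧ (j : ℕ) < n ∧ σ j < σ k) =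
          Finset.Ioi k := by
        ext j
        simp only [Finset.mem_filter, Finset.mem_univ, true_and, Finset.mem_Ioi]
        exact ⟨fun h => h.1, fun h => ⟨h, j.2, hanti h⟩⟩
      rw [code, this, Fin.card_Ioi]
      omega
    simp only [hcode]
    rw [Fin.prod_univ_eq_prod_range (fun k => shiftedPow (k + 1) (n - (k + 1))) n,
      Finset.range_eq_Ico, Finset.prod_Ico_add' (fun k => shiftedPow k (n - k))]
    rfl

/-- A decreasing word followed by an increasing word is dominant, and the code of its first part
is given by the letters. -/
theorem schubert_of_anti_of_mono {n r : ℕ} (hr : r ≤ n) (σ : Equiv.Perm (Fin n))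
    (hanti : ∀ i j : Fin n, i < j → (j : ℕ) < r → σ j < σ i)
    (hmono : ∀ i j : Fin n, r ≤ (i : ℕ) → i < j → σ i < σ j) :
    schubert σ = ∏ k : Fin r, shiftedPow (k + 1) (σ (k.castLE hr)) := by
  have h1 : ∀ k : Fin n, (k : ℕ) < r → code n σ k = σ k := by
    intro k hk
    -- Letters are zero-based, so `σ k` is the number of smaller letters; since the word decreases
    -- up to position `r`, all of them stand to the right of `k`.
    have : (σ k : ℕ) = (Finset.Iio (σ k)).card := (Fin.card_Iio _).symm
    rw [code, this]
    refine Finset.card_equiv σ fun j => ?_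
    simp only [Finset.mem_filter, Finset.mem_univ, true_and, Finset.mem_Iio]
    refine ⟨fun h => h.2.2, fun h => ⟨?_, j.2, h⟩⟩
    by_contra hjk
    rcases (not_lt.1 hjk).lt_or_eq with h' | rfl
    · exact absurd h (hanti j k h' hk).not_gt
    · exact lt_irrefl _ h
  have h2 : ∀ k : Fin n, r ≤ (k : ℕ) → code n σ k = 0 := by
    intro k hk
    rw [code, Finset.card_eq_zero, Finset.filter_eq_empty_iff]
    rintro j - ⟨h, -, h'⟩
    exact absurd h' (hmono k j hk h).not_gt
  have hd : IsDominant n σ := by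
    intro k hk _
    rcases Nat.lt_or_ge (k + 1) r with h | h
    · rw [h1 _ h, h1 ⟨k, _⟩ (by simp only []; omega)]
      exact (hanti _ _ (by simp) h).le
    · rw [h2 _ h]
      exact Nat.zero_le _
  rw [schubert_of_isDominant σ hd]
  obtain ⟨d, rfl⟩ := Nat.exists_eq_add_of_le hr
  rw [Fin.prod_univ_add]
  have h3 : ∀ k : Fin d, shiftedPow (Fin.natAdd r k + 1 : ℕ) (code (r + d) σ (Fin.natAdd r k)) =
      1 := by
    intro k
    rw [h2 _ (by simp)]
    simp [shiftedPow]
  rw [Finset.prod_congr rfl fun k _ => h3 k, Finset.prod_const_one, mul_one]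
  refine Finset.prod_congr rfl fun k _ => ?_
  rw [h1 _ (by simp)]
  rfl

/-! ### Antisymmetrization in the first `r` variables `x` -/

/-- The letters of `Fin r` as the indices `1, …, r`. -/
def indexEquiv (r : ℕ) : Fin r ≃ {i : ℕ // 1 ≤ i ∧ i ≤ r} where
  toFun k := ⟨k + 1, by omega⟩
  invFun i := ⟨i - 1, by have := i.2; omega⟩
  left_inv k := by simp
  right_inv i := by
    have := i.2
    ext
    simp only []
    omega

/-- A permutation of `Fin r` as a permutation of the indices `1, …, r` of the variables. -/
def indexPerm {r : ℕ} (g : Equiv.Perm (Fin r)) : Equiv.Perm ℕ :=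
  g.extendDomain (indexEquiv r)

theorem indexPerm_apply {r : ℕ} (g : Equiv.Perm (Fin r)) (k : Fin r) :
    indexPerm g (k + 1) = g k + 1 :=
  Equiv.Perm.extendDomain_apply_image g (indexEquiv r) k

theorem indexPerm_mul {r : ℕ} (g h : Equiv.Perm (Fin r)) :
    indexPerm (g * h) = indexPerm g * indexPerm h :=
  (Equiv.Perm.extendDomain_mul _ g h).symm

theorem indexPerm_swap {r : ℕ} (i : ℕ) (hi : i + 1 < r) :
    indexPerm (Equiv.swap (⟨i, by omega⟩ : Fin r) ⟨i + 1, hi⟩) =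
      Equiv.swap (i + 1) (i + 1 + 1) := by
  ext k
  by_cases hk : 1 ≤ k ∧ k ≤ r
  · obtain ⟨j, rfl⟩ : ∃ j : Fin r, k = j + 1 := ⟨⟨k - 1, by omega⟩, by simp only []; omega⟩
    rw [indexPerm_apply, Equiv.swap_apply_def, Equiv.swap_apply_def]
    simp only [Fin.ext_iff]
    split_ifs <;> first | omega | rfl
  · rw [indexPerm, Equiv.Perm.extendDomain_apply_not_subtype _ (indexEquiv r) hk,
      Equiv.swap_apply_of_ne_of_ne] <;> omega

/-- The alternating sum of the images of `f` under the permutations of `x₁, …, x_r`. -/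
def antisymm (r : ℕ) (f : Poly) : Poly :=
  ∑ g : Equiv.Perm (Fin r), ((Equiv.Perm.sign g : ℤ) : Poly) * permX (indexPerm g) f

theorem antisymm_sub (r : ℕ) (f g : Poly) :
    antisymm r (f - g) = antisymm r f - antisymm r g := by
  simp only [antisymm, map_sub, mul_sub, Finset.sum_sub_distrib]

theorem antisymm_permX {r : ℕ} (h : Equiv.Perm (Fin r)) (f : Poly) :
    antisymm r (permX (indexPerm h) f) = ((Equiv.Perm.sign h : ℤ) : Poly) * antisymm r f := by
  rw [antisymm, antisymm, Finset.mul_sum]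
  refine Fintype.sum_equiv (Equiv.mulRight h) _ _ fun g => ?_
  rw [Equiv.coe_mulRight, indexPerm_mul, permX_mul, Equiv.Perm.sign_mul]
  have hs : ((Equiv.Perm.sign h : ℤ) : Poly) * ((Equiv.Perm.sign h : ℤ) : Poly) = 1 := by
    rw [← Int.cast_mul, Int.units_coe_mul_self, Int.cast_one]
  rw [Units.val_mul, Int.cast_mul]
  linear_combination (-((Equiv.Perm.sign g : ℤ) : Poly) *
    permX (indexPerm g) (permX (indexPerm h) f)) * hs

theorem antisymm_mul_of_symm {r : ℕ} {g : Poly}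
    (hg : ∀ h : Equiv.Perm (Fin r), permX (indexPerm h) g = g) (f : Poly) :
    antisymm r (f * g) = antisymm r f * g := by
  simp only [antisymm, map_mul, hg, Finset.sum_mul, mul_assoc]

theorem antisymm_swap {r : ℕ} (i : ℕ) (hi : i + 1 < r) (f : Poly) :
    antisymm r (permX (Equiv.swap (i + 1) (i + 1 + 1)) f) = -antisymm r f := by
  rw [← indexPerm_swap i hi, antisymm_permX, Equiv.Perm.sign_swap (by simp)]
  simp

/-- Antisymmetrization does not see the isobaric divided difference `f ↦ x_i ∂_i f`. -/
theorem antisymm_px_mul_divDiff {r : ℕ} (i : ℕ) (hi : i + 1 < r) (f : Poly) :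
    antisymm r (px (i + 1) * divDiff (i + 1) f) = antisymm r f := by
  have h1 := antisymm_swap i hi (px (i + 1) * divDiff (i + 1) f)
  rw [map_mul, permX_px, permX_swap_divDiff, Equiv.swap_apply_left] at h1
  have h2 := antisymm_swap i hi f
  have h3 := congrArg (antisymm r) (divDiff_spec (i + 1) f)
  rw [antisymm_sub, sub_mul, antisymm_sub] at h3
  apply mul_left_cancel₀ (two_ne_zero (α := Poly))
  linear_combination -h3 + h1 - h2

/-- This is the Leibniz expansion; `hf` expresses that `f k i` depends on no `x`-variable other than
`x_i`, and on it in the same way for all `i`. -/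
theorem antisymm_prod {r : ℕ} (f : Fin r → ℕ → Poly)
    (hf : ∀ (π : Equiv.Perm ℕ) k i, permX π (f k i) = f k (π i)) :
    antisymm r (∏ k : Fin r, f k (k + 1)) = (Matrix.of fun j k : Fin r => f k (j + 1)).det := by
  rw [antisymm, Matrix.det_apply']
  refine Finset.sum_congr rfl fun g _ => ?_
  rw [map_prod]
  congr 1
  refine Finset.prod_congr rfl fun k _ => ?_
  rw [hf, indexPerm_apply, Matrix.of_apply]

/-! ### Graßmannian permutations -/

/-- The exponents of `x^{a}`, where `a_i` counts the larger letters between the positions `i` and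
`r`. -/
def cocodeMonomial {n : ℕ} (r : ℕ) (σ : Equiv.Perm (Fin n)) : Poly :=
  ∏ k : Fin n, px (k + 1) ^ (r - (k + 1) - code r σ k)

theorem exists_antisymm_schubert {n r : ℕ} (hr : r ≤ n) (σ : Equiv.Perm (Fin n))
    (hdom : IsDominant r σ) (hmono : ∀ i j : Fin n, r ≤ (i : ℕ) → i < j → σ i < σ j) :
    ∃ t : Fin r → ℕ, StrictAnti t ∧
      (∀ a : ℕ, a ∈ Set.range t ↔ ∃ k : Fin n, (k : ℕ) < r ∧ (σ k : ℕ) = a) ∧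
      antisymm r (cocodeMonomial r σ * schubert σ) =
        antisymm r (∏ k : Fin r, shiftedPow (k + 1) (t k)) := by
  induction hm : ascMeasure σ using Nat.strong_induction_on generalizing σ with
  | _ m ih =>
  subst hm
  -- As long as there is an ascent among the first `r` letters, the first ascent of the whole word
  -- is one too, and exchanging its letters does not change the set of these `r` letters.
  by_cases hex : ∃ i, IsAscent σ i ∧ i + 1 < r
  · obtain ⟨i, hi, hlt, hmin, hS⟩ := exists_first_ascent σ ⟨_, hex.choose_spec.1⟩
    have hir : i + 1 < r := by
      have := hmin _ hex.choose_spec.1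
      have := hex.choose_spec.2
      omega
    have he := hdom.code_eq i hi hir hlt
    obtain ⟨t, ht, htr, hA⟩ := ih _ (ascMeasure_swapAt_lt σ i hi hlt) _
      (hdom.swapAt i hi hir hlt hmin) (fun j k hj hjk => by
        have hjk' : (j : ℕ) < k := hjk
        rw [swapAt_of_ne, swapAt_of_ne] <;> first | exact hmono j k hj hjk | omega) rfl
    refine ⟨t, ht, fun a => (htr a).trans ?_, ?_⟩
    · have hsw : ∀ k : Fin n, (k : ℕ) < r →
          ((Equiv.swap (⟨i, by omega⟩ : Fin n) ⟨i + 1, hi⟩ k : Fin n) : ℕ) < r := by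
        intro k hk
        rw [Equiv.swap_apply_def]
        split_ifs <;> first | omega | (simp only []; omega)
      constructor
      · rintro ⟨k, hk, rfl⟩
        exact ⟨_, hsw k hk, rfl⟩
      · rintro ⟨k, hk, rfl⟩
        refine ⟨_, hsw k hk, ?_⟩
        rw [swapAt, Equiv.Perm.mul_apply]
        simp
    · rw [← hA, hS]
      have hle := code_le (r := r) σ ⟨i + 1, hi⟩
      simp only [] at hle
      set M := cocodeMonomial r (swapAt σ i hi) with hM
      rw [cocodeMonomial, prod_fin_split _ i hi, code_swapAt_left _ _ _ hir hlt,
        code_swapAt_right _ _ _ hlt, he] at hM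
      set c := code r σ ⟨i + 1, hi⟩
      have hR : ∏ k ∈ (Finset.univ.erase (⟨i, by omega⟩ : Fin n)).erase ⟨i + 1, hi⟩,
          px (k + 1) ^ (r - (k + 1) - code r (swapAt σ i hi) k) =
          ∏ k ∈ (Finset.univ.erase (⟨i, by omega⟩ : Fin n)).erase ⟨i + 1, hi⟩,
          px (k + 1) ^ (r - (k + 1) - code r σ k) := Finset.prod_congr rfl fun k hk => by
        obtain ⟨h1, h2⟩ := ne_of_mem_erase_erase hk
        rw [code_swapAt_of_ne _ _ _ hir _ h1 h2]
      rw [hR] at hM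
      -- The exchange raises one code by one, which costs one factor of the monomial; `hle` ensures
      -- that the subtraction is not truncated. In `M` the two variables have equal exponents, so
      -- `M` passes through the divided difference.
      have hMσ : cocodeMonomial r σ = px (i + 1) * M := by
        rw [cocodeMonomial, prod_fin_split _ i hi, hM, he, ← mul_assoc (px (i + 1)), ← pow_succ']
        congr 3
        change r - (i + 1) - c = r - (i + 1) - (c + 1) + 1
        omega
      set R := ∏ k ∈ (Finset.univ.erase (⟨i, by omega⟩ : Fin n)).erase ⟨i + 1, hi⟩,
          px (k + 1) ^ (r - (k + 1) - code r σ k) with hRdef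
      have hRs : permX (Equiv.swap (i + 1) (i + 1 + 1)) R = R := by
        rw [hRdef, map_prod]
        refine Finset.prod_congr rfl fun k hk => ?_
        obtain ⟨h1, h2⟩ := ne_of_mem_erase_erase hk
        rw [map_pow, permX_px, Equiv.swap_apply_of_ne_of_ne] <;> omega
      have hMs : permX (Equiv.swap (i + 1) (i + 1 + 1)) M = M := by
        have hexp : r - (i + 1) - (c + 1) = r - (i + 1 + 1) - c := by omega
        rw [hM]
        simp only [] at hexp ⊢
        rw [map_mul, map_mul, hRs, map_pow, map_pow, permX_px, permX_px, Equiv.swap_apply_left,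
          Equiv.swap_apply_right, hexp]
        ring
      rw [hMσ, mul_assoc, ← divDiff_mul_of_symm hMs, antisymm_px_mul_divDiff i hir]
  · have hanti : ∀ i j : Fin n, i < j → (j : ℕ) < r → σ j < σ i := fun i j hij hj =>
      gt_of_forall_succ_lt (r := r) σ
        (fun k hk hkr => gt_of_not_isAscent hk fun h' => hex ⟨k, h', hkr⟩) hij hj
    refine ⟨fun k => σ (k.castLE hr), fun i j hij => hanti _ _ hij j.2, fun a => ?_, ?_⟩
    · constructor
      · rintro ⟨k, rfl⟩
        exact ⟨_, k.2, rfl⟩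
      · rintro ⟨k, hk, rfl⟩
        exact ⟨⟨k, hk⟩, rfl⟩
    · rw [schubert_of_anti_of_mono hr σ hanti hmono]
      have hc : cocodeMonomial r σ = 1 := by
        refine Finset.prod_eq_one fun k _ => ?_
        convert pow_zero _
        rcases Nat.lt_or_ge k r with hk | hk
        · have h1 : ((Finset.univ.filter fun j : Fin n => (k : ℕ) < j ∧ (j : ℕ) < r).card) =
              r - (k + 1) := by
            rw [show r - (k + 1) = r - k - 1 by omega, ← Nat.card_Ioo, ← Finset.card_map Fin.valEmbedding]
            congr 1
            ext a
            simp only [Finset.mem_map, Finset.mem_filter, Finset.mem_univ, true_and,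
              Finset.mem_Ioo, Fin.valEmbedding_apply]
            constructor
            · rintro ⟨j, hj, rfl⟩
              exact hj
            · intro ha
              exact ⟨⟨a, by omega⟩, ha, rfl⟩
          have h2 : code r σ k = r - (k + 1) := by
            rw [← h1, code]
            congr 1
            ext j
            simp only [Finset.mem_filter, Finset.mem_univ, true_and]
            exact ⟨fun h => ⟨h.1, h.2.1⟩, fun h => ⟨h.1, h.2, hanti _ _ h.1 h.2⟩⟩
          omega
        · omega
      rw [hc, one_mul]

/-- The double Schubert polynomial of a permutation without descent before position `r` is
symmetric in `x₁, …, x_r`. -/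
theorem permX_schubert {n r : ℕ} (hr : r ≤ n) (σ : Equiv.Perm (Fin n))
    (hmono : ∀ i j : Fin n, i < j → (j : ℕ) < r → σ i < σ j) (g : Equiv.Perm (Fin r)) :
    permX (indexPerm g) (schubert σ) = schubert σ := by
  cases r with
  | zero =>
    have : indexPerm g = 1 := by
      rw [Subsingleton.elim g 1]
      exact Equiv.Perm.extendDomain_one _
    rw [this, permX_one]
  | succ r =>
    -- Adjacent transpositions generate the symmetric group, and each fixes the polynomial because
    -- `σ` has an ascent there.
    have hg : g ∈ Submonoid.closure
        (Set.range fun i : Fin r => Equiv.swap i.castSucc i.succ) := by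
      rw [Equiv.Perm.mclosure_swap_castSucc_succ]
      trivial
    induction hg using Submonoid.closure_induction with
    | mem g hg =>
      obtain ⟨i, rfl⟩ := hg
      have := indexPerm_swap (r := r + 1) i (by omega)
      change permX (indexPerm (Equiv.swap (⟨i, by omega⟩ : Fin (r + 1)) ⟨i + 1, by omega⟩)) _ = _
      rw [this]
      exact permX_swap_schubert σ i (by omega) (hmono _ _ (by simp) (by simp))
    | one =>
      have : indexPerm (1 : Equiv.Perm (Fin (r + 1))) = 1 := Equiv.Perm.extendDomain_one _
      rw [this, permX_one]
    | mul a b _ _ ha hb => rw [indexPerm_mul, permX_mul, hb, ha]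

/-- The bialternant formula for the double Schubert polynomial of a Graßmannian permutation. -/
theorem schubert_mul_prod {n r : ℕ} (hr : r ≤ n) (σ : Equiv.Perm (Fin n))
    (hlt : ∀ i j : Fin n, i < j → (j : ℕ) < r → σ i < σ j)
    (hge : ∀ i j : Fin n, r ≤ (i : ℕ) → i < j → σ i < σ j) :
    schubert σ * ∏ i : Fin r, ∏ j ∈ Finset.Ioi i, (px (r - j) - px (r - i)) =
      (Matrix.of fun i j : Fin r => shiftedPow (r - j) (σ (i.castLE hr))).det := by
  have hcode : ∀ k : Fin n, (k : ℕ) < r → code r σ k = 0 := by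
    intro k hk
    rw [code, Finset.card_eq_zero, Finset.filter_eq_empty_iff]
    rintro j - ⟨h, hj, h'⟩
    exact absurd h' (hlt k j h hj).not_gt
  have hdom : IsDominant r σ := fun k hk hkr => by
    rw [hcode _ hkr]
    exact Nat.zero_le _
  obtain ⟨t, ht, htr, hA⟩ := exists_antisymm_schubert hr σ hdom hge
  -- `t` enumerates decreasingly the letters that `σ` lists increasingly, and a strictly monotone
  -- enumeration is determined by its range.
  have htσ : ∀ k, t k = σ ((Fin.rev k).castLE hr) := by
    have h1 : StrictMono fun k => t (Fin.rev k) := fun i j hij => ht (Fin.rev_lt_rev.2 hij)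
    have h2 : StrictMono fun k : Fin r => (σ (k.castLE hr) : ℕ) := fun i j hij =>
      hlt _ _ hij j.2
    have h3 : Set.range (fun k => t (Fin.rev k)) =
        Set.range fun k : Fin r => (σ (k.castLE hr) : ℕ) := by
      ext a
      have : a ∈ Set.range (fun k => t (Fin.rev k)) ↔ a ∈ Set.range t := by
        rw [show (fun k => t (Fin.rev k)) = t ∘ Fin.rev from rfl,
          Fin.rev_surjective.range_comp]
      rw [this, htr]
      constructor
      · rintro ⟨k, hk, rfl⟩
        exact ⟨⟨k, hk⟩, rfl⟩
      · rintro ⟨k, rfl⟩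
        exact ⟨_, k.2, rfl⟩
    intro k
    have := congrFun ((h1.range_inj h2).1 h3) (Fin.rev k)
    simpa using this
  have hmon : cocodeMonomial r σ = ∏ k : Fin r, px (k + 1) ^ (r - (k + 1)) := by
    obtain ⟨d, rfl⟩ := Nat.exists_eq_add_of_le hr
    rw [cocodeMonomial, Fin.prod_univ_add]
    rw [Finset.prod_congr rfl fun (k : Fin d) _ =>
      show px (Fin.natAdd r k + 1 : ℕ) ^ _ = 1 by
        convert pow_zero _
        simp only [Fin.val_natAdd]
        omega, Finset.prod_const_one, mul_one]
    refine Finset.prod_congr rfl fun k _ => ?_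
    rw [hcode _ (by simp)]
    rfl
  rw [antisymm_mul_of_symm (permX_schubert hr σ hlt), hmon,
    antisymm_prod (fun k i => px i ^ (r - (k + 1))) (fun π k i => by rw [map_pow, permX_px]),
    antisymm_prod (fun k i => shiftedPow i (t k)) (fun π k i => permX_shiftedPow _ _ _)] at hA
  -- Reversing rows and columns simultaneously keeps both determinants and produces increasing
  -- powers, as in Mathlib's Vandermonde matrix.
  rw [← Matrix.det_submatrix_equiv_self Fin.revPerm,
    ← Matrix.det_submatrix_equiv_self Fin.revPerm (Matrix.of fun j k : Fin r =>
      shiftedPow (j + 1) (t k))] at hA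
  have hV : ((Matrix.of fun j k : Fin r => px (j + 1) ^ (r - (k + 1))).submatrix
      Fin.revPerm Fin.revPerm) = Matrix.vandermonde fun j : Fin r => px (r - j) := by
    ext1 i j
    simp only [Matrix.submatrix_apply, Matrix.of_apply, Matrix.vandermonde_apply,
      Fin.revPerm_apply, Fin.val_rev]
    congr 2 <;> omega
  rw [hV, Matrix.det_vandermonde] at hA
  rw [mul_comm, hA, ← Matrix.det_transpose]
  congr 1
  ext1 i j
  simp only [Matrix.submatrix_apply, Matrix.of_apply, Matrix.transpose_apply,
    Fin.revPerm_apply, Fin.val_rev, htσ, Fin.rev_rev]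
  congr 1
  omega

/-! ### Columns with bounded entries and their complements -/

/-- The columns with entries at most `b`. -/
def columnsLE : ℕ → Finset (List ℕ)
  | 0 => {[]}
  | b + 1 => columnsLE b ∪ (columnsLE b).image (List.cons (b + 1))

theorem mem_columnsLE {b : ℕ} {v : List ℕ} :
    v ∈ columnsLE b ↔ IsColumn v ∧ ∀ a ∈ v, a ≤ b := by
  induction b generalizing v with
  | zero =>
    rw [columnsLE, Finset.mem_singleton]
    constructor
    · rintro rfl
      simp [IsColumn]
    · rintro ⟨h1, h2⟩
      refine List.eq_nil_iff_forall_not_mem.2 fun a ha => ?_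
      have := h1.2 a ha
      have := h2 a ha
      omega
  | succ b ih =>
    rw [columnsLE, Finset.mem_union, Finset.mem_image, ih]
    constructor
    · rintro (⟨h1, h2⟩ | ⟨w, hw, rfl⟩)
      · exact ⟨h1, fun a ha => (h2 a ha).trans (Nat.le_succ b)⟩
      · obtain ⟨⟨h1, h2⟩, h3⟩ := ih.1 hw
        refine ⟨⟨List.pairwise_cons.2 ⟨fun a ha => Nat.lt_succ_of_le (h3 a ha), h1⟩, ?_⟩, ?_⟩
        · simpa using h2
        · simpa using fun a ha => (h3 a ha).trans (Nat.le_succ b)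
    · rintro ⟨h1, h2⟩
      match v, h1, h2 with
      | [], h1, _ => exact Or.inl ⟨h1, by simp⟩
      | c :: w, ⟨h1, h1'⟩, h2 =>
        have h3 := List.pairwise_cons.1 h1
        have hc := h2 c (by simp)
        rcases Nat.lt_or_ge b c with h | h
        · obtain rfl : c = b + 1 := by omega
          exact Or.inr ⟨w, ih.2 ⟨⟨h3.2, fun a ha => h1' a (by simp [ha])⟩,
            fun a ha => Nat.le_of_lt_succ (h3.1 a ha)⟩, rfl⟩
        · refine Or.inl ⟨⟨h1, h1'⟩, fun a ha => ?_⟩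
          rcases List.mem_cons.1 ha with rfl | ha
          · exact h
          · exact (h3.1 a ha).le.trans h

theorem sum_columnsLE_succ {M : Type*} [AddCommMonoid M] (b : ℕ) (f : List ℕ → M) :
    ∑ v ∈ columnsLE (b + 1), f v =
      ∑ v ∈ columnsLE b, f v + ∑ v ∈ columnsLE b, f ((b + 1) :: v) := by
  rw [columnsLE, Finset.sum_union, Finset.sum_image]
  · exact fun v _ w _ h => (List.cons.inj h).2
  · rw [Finset.disjoint_left]
    intro v hv hv'
    obtain ⟨w, -, rfl⟩ := Finset.mem_image.1 hv'
    have := (mem_columnsLE.1 hv).2 (b + 1) (by simp)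
    omega

theorem complement_succ_of_le {b : ℕ} {v : List ℕ} (hv : ∀ a ∈ v, a ≤ b) :
    complement (b + 1) v = complement b v ++ [b + 1] := by
  have : b + 1 ∉ v := fun h => by
    have := hv _ h
    omega
  rw [complement, complement, List.range'_1_concat, List.filter_append]
  simp [add_comm 1 b, this]

theorem complement_succ_cons (b : ℕ) (v : List ℕ) :
    complement (b + 1) ((b + 1) :: v) = complement b v := by
  rw [complement, complement, List.range'_1_concat, List.filter_append]
  simp only [add_comm 1 b, List.filter_singleton, List.mem_cons, true_or, not_true_eq_false,
    decide_false]
  rw [show (bif false then [b + 1] else []) = ([] : List ℕ) from rfl, List.append_nil]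
  refine List.filter_congr fun a ha => ?_
  have := (List.mem_range'_1.1 ha).2
  have h : a ≠ b + 1 := by omega
  simp [h]

theorem length_complement {n : ℕ} {u : List ℕ} (hu : IsColumn u) (hn : ∀ a ∈ u, a ≤ n) :
    (complement n u).length + u.length = n := by
  simpa using (complement_append_perm hu hn).length_eq

/-! ### The weight of a pair of adjacent columns -/

open Classical in
/-- The weight of the column `u` after the column `v`, or `0` if the two are not adjacent. -/
def adjWeight (z : RatFun) (v u : List ℕ) : RatFun :=
  if Adjacent v u then columnWeight z v u else 0

theorem adjWeight_of_length_ne {v u : List ℕ} (h : v.length ≠ u.length + 1) (z : RatFun) :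
    adjWeight z v u = 0 :=
  if_neg fun h' => h h'.1

theorem adjWeight_singleton_nil (z : RatFun) (a : ℕ) : adjWeight z [a] [] = 1 := by
  rw [adjWeight, if_pos ⟨rfl, by simp⟩]
  simp [columnWeight]

theorem adjacent_cons_cons_cons {a b c : ℕ} {u v : List ℕ} :
    Adjacent (a :: c :: v) (b :: u) ↔ (c ≤ b ∧ b ≤ a) ∧ Adjacent (c :: v) u := by
  simp only [Adjacent, List.length_cons, Nat.forall_lt_succ_left, List.getD_cons_succ,
    List.getD_cons_zero]
  constructor
  · rintro ⟨h1, h2, h3⟩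
    exact ⟨h2, by omega, h3⟩
  · rintro ⟨h2, h1, h3⟩
    exact ⟨by omega, h2, h3⟩

theorem adjWeight_cons_cons_cons (z : RatFun) (a b c : ℕ) (u v : List ℕ) :
    adjWeight z (a :: c :: v) (b :: u) =
      (if c ≤ b ∧ b ≤ a then
        if c = b then z / y b - 1 else if c < b ∧ b < a then z / y b else 1
      else 0) * adjWeight z (c :: v) u := by
  have hw : columnWeight z (a :: c :: v) (b :: u) =
      (if c = b then z / y b - 1 else if c < b ∧ b < a then z / y b else 1) *
        columnWeight z (c :: v) u := by
    rw [columnWeight, List.length_cons, Finset.prod_range_succ', mul_comm]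
    rfl
  unfold adjWeight
  rw [adjacent_cons_cons_cons, hw]
  by_cases h1 : c ≤ b ∧ b ≤ a <;> by_cases h2 : Adjacent (c :: v) u <;> simp [h1, h2]

/-- The top entry of the left column only serves as an upper bound, so its value does not matter
once it exceeds all of `u`. -/
theorem adjWeight_cons_congr (z : RatFun) {a a' : ℕ} {u v : List ℕ} (ha : ∀ b ∈ u, b < a)
    (ha' : ∀ b ∈ u, b < a') : adjWeight z (a :: v) u = adjWeight z (a' :: v) u := by
  match u, v with
  | [], [] => rw [adjWeight_singleton_nil, adjWeight_singleton_nil]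
  | [], c :: v => rw [adjWeight_of_length_ne (by simp), adjWeight_of_length_ne (by simp)]
  | b :: u, [] => rw [adjWeight_of_length_ne (by simp), adjWeight_of_length_ne (by simp)]
  | b :: u, c :: v =>
    have h1 := ha b (by simp)
    have h2 := ha' b (by simp)
    simp only [adjWeight_cons_cons_cons, h1, h2, h1.le, h2.le]

/-! ### The transfer of a column, one value at a time -/

theorem map_complement_succ_prod {L : Type*} [Monoid L] (e : ℕ → L) {b : ℕ} {v : List ℕ} (hv : v ∈ columnsLE b) :
    ((complement (b + 1) v).map e).prod = ((complement b v).map e).prod * e (b + 1) := by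
  rw [complement_succ_of_le (mem_columnsLE.1 hv).2]
  simp

section Transfer

variable {L : Type*} [Ring L] [Algebra RatFun L] (e : ℕ → L) (z : RatFun)

/-- The sum over all columns `v` to the left of `u` of the weight of `u` times the
word of the complement of `v`. -/
def transfer (b : ℕ) (u : List ℕ) : L :=
  ∑ v ∈ columnsLE b, adjWeight z v u • ((complement b v).map e).prod

/-- The part of `transfer` in which the left column has an additional entry above `b`. -/
def transferTop (b : ℕ) (u : List ℕ) : L :=
  ∑ v ∈ columnsLE b, adjWeight z ((b + 1) :: v) u • ((complement b v).map e).prod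

/-- The left column omits or contains `b + 1`; if it omits it, its complement gains the last letter
`b + 1`. -/
theorem transfer_succ_of_le {b : ℕ} {u : List ℕ} :
    transfer e z (b + 1) u = transfer e z b u * e (b + 1) + transferTop e z b u := by
  rw [transfer, sum_columnsLE_succ, transfer, transferTop, Finset.sum_mul]
  congr 1
  · refine Finset.sum_congr rfl fun v hv => ?_
    rw [map_complement_succ_prod e hv, smul_mul_assoc]
  · refine Finset.sum_congr rfl fun v _ => ?_
    rw [complement_succ_cons]

/-- A left column with both `b + 2` and `b + 1` would force the top of `u` to be at least `b + 1`.
So `b + 1` lies in the left complement, and the top entry `b + 2` may be lowered to `b + 1`. -/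
theorem transferTop_succ_of_le {b : ℕ} {u : List ℕ} (hu : ∀ a ∈ u, a ≤ b) :
    transferTop e z (b + 1) u = transferTop e z b u * e (b + 1) := by
  rw [transferTop, sum_columnsLE_succ, transferTop, Finset.sum_mul]
  conv_rhs => rw [← add_zero (Finset.sum _ _)]
  congr 1
  · refine Finset.sum_congr rfl fun v hv => ?_
    rw [map_complement_succ_prod e hv, smul_mul_assoc,
      adjWeight_cons_congr z (a' := b + 1) (fun c hc => by have := hu c hc; omega)
        (fun c hc => by have := hu c hc; omega)]
  · refine Finset.sum_eq_zero fun v _ => ?_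
    match u, hu with
    | [], _ => rw [adjWeight_of_length_ne (by simp), zero_smul]
    | c :: u, hu =>
      have := hu c (by simp)
      rw [adjWeight_cons_cons_cons, if_neg (by omega), zero_mul, zero_smul]

/-- The left column must reach the height of the top entry `b + 1`, hence contains it; that entry of
`u` then equals its upper bound and has weight `1`. -/
theorem transfer_succ_cons {b : ℕ} {u : List ℕ} :
    transfer e z (b + 1) ((b + 1) :: u) = transfer e z b u := by
  rw [transfer, sum_columnsLE_succ, transfer]
  conv_rhs => rw [← zero_add (Finset.sum _ _)]
  congr 1
  · refine Finset.sum_eq_zero fun v hv => ?_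
    match v, hv with
    | [], _ => rw [adjWeight_of_length_ne (by simp), zero_smul]
    | [c], _ => rw [adjWeight_of_length_ne (by simp), zero_smul]
    | d :: c :: v, hv =>
      have := (mem_columnsLE.1 hv).2 d (by simp)
      rw [adjWeight_cons_cons_cons, if_neg (by omega), zero_mul, zero_smul]
  · refine Finset.sum_congr rfl fun v hv => ?_
    rw [complement_succ_cons]
    match v, hv with
    | [], _ => rw [adjWeight_of_length_ne (by simp), adjWeight_of_length_ne (by simp)]
    | c :: v, hv =>
      have := (mem_columnsLE.1 hv).2 c (by simp)
      rw [adjWeight_cons_cons_cons, if_pos (by omega), if_neg (by omega), if_neg (by omega),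
        one_mul]

/-- Under the top entry `b + 2`, the entry `b + 1` of `u` has either a smaller left neighbour
(weight `z/y`) or an equal one (weight `z/y - 1`). -/
theorem transferTop_succ_cons {b : ℕ} {u : List ℕ} :
    transferTop e z (b + 1) ((b + 1) :: u) =
      (z / y (b + 1)) • (transfer e z b u * e (b + 1)) +
        (z / y (b + 1) - 1) • transferTop e z b u := by
  rw [transferTop, sum_columnsLE_succ, transferTop, transfer, Finset.sum_mul, Finset.smul_sum,
    Finset.smul_sum]
  congr 1
  · refine Finset.sum_congr rfl fun v hv => ?_
    rw [map_complement_succ_prod e hv, smul_mul_assoc, smul_smul]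
    match v, hv with
    | [], _ => rw [adjWeight_of_length_ne (by simp), adjWeight_of_length_ne (by simp), mul_zero]
    | c :: v, hv =>
      have := (mem_columnsLE.1 hv).2 c (by simp)
      rw [adjWeight_cons_cons_cons, if_pos (by omega), if_neg (by omega), if_pos (by omega)]
  · refine Finset.sum_congr rfl fun v hv => ?_
    rw [complement_succ_cons, adjWeight_cons_cons_cons, if_pos (by omega), if_pos rfl, smul_smul]

end Transfer

/-! ### The transfer in the exterior algebra -/

/-- `(w/y₁ - 1) ⋯ (w/y_{s-1} - 1)`. -/
def ratPow (s : ℕ) (w : RatFun) : RatFun := ∏ b ∈ Finset.Ico 1 s, (w / y b - 1)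

theorem ratPow_one (w : RatFun) : ratPow 1 w = 1 := by simp [ratPow]

theorem ratPow_succ_succ (b : ℕ) (w : RatFun) :
    ratPow (b + 1 + 1) w = ratPow (b + 1) w * (w / y (b + 1) - 1) :=
  Finset.prod_Ico_succ_top (by omega) _

theorem y_ne_zero (j : ℕ) : y j ≠ 0 := by
  rw [y, Ne, FaithfulSMul.algebraMap_eq_zero_iff]
  exact MvPolynomial.X_ne_zero _

/-- The vector of the values of `ratPow s`. -/
def powVec {m : ℕ} (w : Fin m → RatFun) (s : ℕ) : Fin m → RatFun := fun j => ratPow s (w j)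

/-- The total contribution of the entries of the left complement between two consecutive
entries `a < c` of the right complement. -/
def linkVec {m : ℕ} (z : RatFun) (w : Fin m → RatFun) (c a : ℕ) : Fin m → RatFun := fun j =>
  w j / (w j - z) * (ratPow c (w j) - ratPow c z / ratPow a z * ratPow a (w j))

/-- The value of the transfer for a decreasing complement. -/
def transferValue {m : ℕ} (z : RatFun) (w : Fin m → RatFun) :
    List ℕ → ExteriorAlgebra RatFun (Fin m → RatFun)
  | [] => 0
  | [s] => algebraMap RatFun _ (ratPow s z)
  | c :: a :: T => transferValue z w (a :: T) * ExteriorAlgebra.ι RatFun (linkVec z w c a)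

/-- The value of `transferTop` for a decreasing complement. -/
def transferTopValue {m : ℕ} (z : RatFun) (w : Fin m → RatFun) (b : ℕ) :
    List ℕ → ExteriorAlgebra RatFun (Fin m → RatFun)
  | [] => algebraMap RatFun _ (ratPow (b + 1) z)
  | a :: T => transferValue z w (a :: T) *
      ExteriorAlgebra.ι RatFun (linkVec z w (b + 1) a - powVec w (b + 1))

section

variable {m : ℕ} {z : RatFun} {w : Fin m → RatFun}

/-- A gap just opened at `b + 1`. The difference quotient of `w/y_{b+1} - 1` is `1/y_{b+1}`, so the
link is `w/y_{b+1}` times `P_{b+1}(w)`. -/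
theorem linkVec_succ_self (hz : ∀ s, ratPow s z ≠ 0) (hw : ∀ j, w j ≠ z) (b : ℕ) :
    linkVec z w (b + 1 + 1) (b + 1) - powVec w (b + 1 + 1) = powVec w (b + 1) := by
  funext j
  have h1 := hz (b + 1)
  have h2 := sub_ne_zero.2 (hw j)
  have h3 := y_ne_zero (b + 1)
  simp only [Pi.sub_apply, linkVec, powVec, ratPow_succ_succ]
  field_simp
  ring

/-- This is the recurrence of `transferTop_succ_cons` for a single gap: it says how the link grows
while `u` contains `b + 1`. -/
theorem linkVec_succ (hz : ∀ s, ratPow s z ≠ 0) (hw : ∀ j, w j ≠ z) (b a : ℕ) :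
    linkVec z w (b + 1 + 1) a - powVec w (b + 1 + 1) =
      (z / y (b + 1)) • powVec w (b + 1) +
        (z / y (b + 1) - 1) • (linkVec z w (b + 1) a - powVec w (b + 1)) := by
  funext j
  have h1 := hz a
  have h2 := sub_ne_zero.2 (hw j)
  have h3 := y_ne_zero (b + 1)
  simp only [Pi.sub_apply, Pi.add_apply, Pi.smul_apply, smul_eq_mul, linkVec, powVec,
    ratPow_succ_succ]
  field_simp
  ring

/-- The closed forms satisfy the same recurrences in `b` as the two sums. Both statements are proved
together since each recurrence mixes them. -/
theorem transfer_eq (hz : ∀ s, ratPow s z ≠ 0) (hw : ∀ j, w j ≠ z) (b : ℕ) (u : List ℕ)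
    (hu : u ∈ columnsLE b) :
    transfer (fun s => ExteriorAlgebra.ι RatFun (powVec w s)) z b u =
        transferValue z w (complement b u).reverse ∧
      transferTop (fun s => ExteriorAlgebra.ι RatFun (powVec w s)) z b u =
        transferTopValue z w b (complement b u).reverse := by
  induction b generalizing u with
  | zero =>
    obtain rfl : u = [] := by simpa [columnsLE] using hu
    constructor
    · simp [transfer, columnsLE, adjWeight_of_length_ne, complement, transferValue]
    · simp [transferTop, columnsLE, adjWeight_singleton_nil, complement, transferTopValue,
        ratPow_one]
  | succ b ih =>
    rw [columnsLE, Finset.mem_union, Finset.mem_image] at hu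
    rcases hu with hu | ⟨u, hu, rfl⟩
    · have hub := (mem_columnsLE.1 hu).2
      rw [transfer_succ_of_le, transferTop_succ_of_le _ _ hub, (ih u hu).1, (ih u hu).2,
        complement_succ_of_le hub, List.reverse_append, List.reverse_singleton,
        List.singleton_append, transferTopValue, linkVec_succ_self hz hw]
      match (complement b u).reverse with
      | [] => simp [transferValue, transferTopValue]
      | a :: T =>
        simp only [transferValue, transferTopValue]
        constructor
        · rw [← mul_add, ← map_add, add_sub_cancel]
        -- The closed form contains the full link up to `b + 1`, the sum only the link without its
        -- term at `b + 1`; multiplied by the vector of `b + 1`, the two agree as its square is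
        -- zero.
        · rw [map_sub, mul_sub, sub_mul, mul_assoc _ (ExteriorAlgebra.ι RatFun (powVec w (b + 1))),
            ExteriorAlgebra.ι_sq_zero, mul_zero, sub_zero]
    · rw [transfer_succ_cons, transferTop_succ_cons, (ih u hu).1, (ih u hu).2,
        complement_succ_cons]
      refine ⟨rfl, ?_⟩
      match (complement b u).reverse with
      | [] =>
        simp only [transferValue, transferTopValue, zero_mul, smul_zero, zero_add]
        rw [ratPow_succ_succ, mul_comm, map_mul, ← Algebra.smul_def]
      | a :: T =>
        simp only [transferTopValue]
        rw [linkVec_succ hz hw, map_add, map_smul, map_smul, mul_add, mul_smul_comm,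
          mul_smul_comm]

theorem transferValue_ofFn {p : ℕ} (s : Fin (p + 1) → ℕ) :
    transferValue z w (List.ofFn s).reverse =
      ratPow (s 0) z • ExteriorAlgebra.ιMulti RatFun p
        fun i => linkVec z w (s i.succ) (s i.castSucc) := by
  rw [ExteriorAlgebra.ιMulti_apply]
  induction p with
  | zero =>
    simp [transferValue, Algebra.algebraMap_eq_smul_one]
  | succ p ih =>
    have h := ih fun i => s i.castSucc
    rw [List.ofFn_succ', List.ofFn_succ', List.concat_eq_append, List.concat_eq_append,
      List.reverse_append, List.reverse_append, List.reverse_singleton, List.reverse_singleton,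
      List.singleton_append, List.singleton_append, transferValue]
    rw [List.ofFn_succ', List.concat_eq_append, List.reverse_append, List.reverse_singleton,
      List.singleton_append] at h
    rw [h, List.ofFn_succ', List.concat_eq_append, List.prod_append, List.prod_singleton,
      smul_mul_assoc]
    rfl

/-- Subtracting from each row the multiple of the preceding one that cancels its entry in the column
of `z` leaves only the top entry there. Expansion along this column gives the links, up to the
column factors `w_j / (w_j - z)`. -/
theorem ratPow_mul_det_linkVec (s : Fin (m + 1) → ℕ) (hz : ∀ s, ratPow s z ≠ 0) :
    ratPow (s 0) z * (Matrix.of fun i : Fin m => linkVec z w (s i.succ) (s i.castSucc)).det =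
      (∏ j, w j / (w j - z)) * (Matrix.of fun i j : Fin (m + 1) =>
        ratPow (s i) ((Fin.cons z w : Fin (m + 1) → RatFun) j)).det := by
  set A : Matrix (Fin (m + 1)) (Fin (m + 1)) RatFun := Matrix.of fun i j =>
    ratPow (s i) ((Fin.cons z w : Fin (m + 1) → RatFun) j) with hA
  set c : Fin m → RatFun := fun i => ratPow (s i.succ) z / ratPow (s i.castSucc) z with hc
  set B : Matrix (Fin (m + 1)) (Fin (m + 1)) RatFun := Matrix.of fun i j =>
    (Fin.cons (A 0 j) fun k : Fin m => A k.succ j - c k * A k.castSucc j : Fin (m + 1) → RatFun) i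
    with hB
  have hAB : A.det = B.det := by
    refine Matrix.det_eq_of_forall_row_eq_smul_add_pred c (fun j => ?_) fun i j => ?_
    · simp [hB]
    · simp [hB]
  have hA0 : ∀ i, A i 0 = ratPow (s i) z := fun i => by simp [hA]
  have hB0 : ∀ i : Fin m, B i.succ 0 = 0 := fun i => by
    simp only [hB, hc, Matrix.of_apply, Fin.cons_succ, hA0]
    rw [div_mul_cancel₀ _ (hz _), sub_self]
  rw [hAB, Matrix.det_succ_column_zero, Fin.sum_univ_succ, Finset.sum_eq_zero fun i _ => by
    rw [hB0, mul_zero, zero_mul], add_zero]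
  have hB00 : B 0 0 = ratPow (s 0) z := by simp [hB, hA0]
  rw [hB00, Fin.val_zero, pow_zero, one_mul, mul_left_comm, ← Matrix.det_mul_row]
  congr 2

theorem map_eq_ofFn_getD {α : Type*} (f : ℕ → α) {S : List ℕ} (hS : S.length = m) :
    S.map f = List.ofFn fun i : Fin m => f (S.getD i 0) := by
  subst hS
  apply List.ext_getElem (by simp)
  intro i h1 h2
  simp

/-- Transferring a column turns the determinant of the complement in `m` variables into the
determinant in `m + 1` variables. -/
theorem sum_adjWeight_mul_det {n : ℕ} {u : List ℕ} (hu : u ∈ columnsLE n)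
    (hlen : u.length + (m + 1) = n) (hz : ∀ s, ratPow s z ≠ 0) (hw : ∀ j, w j ≠ z) :
    ∑ v ∈ columnsLE n, adjWeight z v u *
        (Matrix.of fun i j : Fin m => ratPow ((complement n v).getD i 0) (w j)).det =
      (∏ j, w j / (w j - z)) * (Matrix.of fun i j : Fin (m + 1) =>
        ratPow ((complement n u).getD i 0) ((Fin.cons z w : Fin (m + 1) → RatFun) j)).det := by
  have hu' := mem_columnsLE.1 hu
  -- The linear form on the exterior algebra that is the determinant in degree `m` and zero in all
  -- other degrees.
  set φ := ExteriorAlgebra.liftAlternating (R := RatFun) (M := Fin m → RatFun) (N := RatFun)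
    (Function.update 0 m Matrix.detRowAlternating) with hφ
  have hφm : ∀ v : Fin m → Fin m → RatFun,
      φ (ExteriorAlgebra.ιMulti RatFun m v) = (Matrix.of v).det := by
    intro v
    rw [hφ, ExteriorAlgebra.liftAlternating_apply_ιMulti, Function.update_self]
    rfl
  have h := congrArg φ (transfer_eq hz hw n u hu).1
  have hS : (complement n u).length = m + 1 := by
    have := length_complement hu'.1 hu'.2
    omega
  rw [← List.map_id (complement n u), map_eq_ofFn_getD id hS, transferValue_ofFn, map_smul, hφm,
    smul_eq_mul] at h
  refine Eq.trans ?_ (h.trans (ratPow_mul_det_linkVec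
    (fun i : Fin (m + 1) => (complement n u).getD i 0) hz))
  rw [transfer, map_sum]
  refine Finset.sum_congr rfl fun v hv => ?_
  rw [map_smul, smul_eq_mul]
  -- Only columns of this length have a complement with `m` elements; all others have weight zero,
  -- so their meaningless determinants do not count.
  by_cases hvl : v.length = u.length + 1
  · have hv' := mem_columnsLE.1 hv
    have hS : (complement n v).length = m := by
      have := length_complement hv'.1 hv'.2
      omega
    rw [map_eq_ofFn_getD _ hS, ← ExteriorAlgebra.ιMulti_apply, hφm]
    rfl
  · rw [adjWeight_of_length_ne hvl, zero_mul, zero_mul]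

end

/-! ### Removing the last column of a staircase -/

theorem length_fullColumn (n : ℕ) : (fullColumn n).length = n := by simp [fullColumn]

theorem fullColumn_mem_columnsLE (n : ℕ) : fullColumn n ∈ columnsLE n := by
  rw [mem_columnsLE, IsColumn, fullColumn, List.pairwise_reverse]
  simp only [List.mem_reverse, List.mem_range'_1]
  exact ⟨⟨List.pairwise_lt_range', fun a ha => by omega⟩, fun a ha => by omega⟩

theorem eq_fullColumn {n : ℕ} {u : List ℕ} (hu : u ∈ columnsLE n) (hlen : u.length = n) :
    u = fullColumn n := by
  obtain ⟨hu, hn⟩ := mem_columnsLE.1 hu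
  have h := complement_append_perm hu hn
  have hl := length_complement hu hn
  rw [List.eq_nil_of_length_eq_zero (by omega : (complement n u).length = 0),
    List.nil_append] at h
  have h1 : u.reverse.Pairwise (· < ·) := List.pairwise_reverse.2 hu.1
  have := h.eq_of_pairwise (fun a b _ _ h1 h2 => absurd h1 h2.not_gt) h1 List.pairwise_lt_range'
  rw [fullColumn, ← this, List.reverse_reverse]

theorem Adjacent.le_of_forall_le {n : ℕ} {v u : List ℕ} (h : Adjacent v u)
    (hv : ∀ a ∈ v, a ≤ n) : ∀ a ∈ u, a ≤ n := by
  intro a ha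
  obtain ⟨k, hk, rfl⟩ := List.mem_iff_getElem.1 ha
  have h1 := (h.2 k hk).2
  have hk' : k < v.length := by have := h.1; omega
  rw [List.getD_eq_getElem _ _ hk, List.getD_eq_getElem _ _ hk'] at h1
  exact h1.trans (hv _ (List.getElem_mem hk'))

theorem chain_length_and_le {n : ℕ} {v a : List ℕ} {t : List (List ℕ)}
    (hc : (a :: t).IsChain Adjacent) (ha : ∀ b ∈ a, b ≤ n) (hl : (a :: t).getLast? = some v) :
    a.length = v.length + t.length ∧ ∀ b ∈ v, b ≤ n := by
  induction t generalizing a with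
  | nil =>
    obtain rfl : a = v := by simpa using hl
    exact ⟨rfl, ha⟩
  | cons c t ih =>
    have h := List.isChain_cons_cons.1 hc
    rw [List.getLast?_cons_cons] at hl
    have h1 := ih h.2 (h.1.le_of_forall_le ha) hl
    have h2 := h.1.1
    exact ⟨by rw [List.length_cons]; omega, h1.2⟩

/-- Lengths drop by one at each step, so the last column determines the number of columns, and
thereby the index of the `x`-variable of a column appended to it. -/
theorem mem_staircases_fullColumn {n : ℕ} {v : List ℕ} {t : List (List ℕ)}
    (ht : t ∈ staircases (fullColumn n) v) : n + 1 = v.length + t.length ∧ v ∈ columnsLE n := by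
  obtain ⟨⟨h1, h2⟩, h3, h4⟩ := ht
  have hv : IsColumn v := h1 v (List.mem_of_getLast? h4)
  match t, h2, h3, h4 with
  | a :: t, h2, h3, h4 =>
    obtain rfl : a = fullColumn n := by simpa using h3
    have h := chain_length_and_le h2 (mem_columnsLE.1 (fullColumn_mem_columnsLE n)).2 h4
    rw [length_fullColumn] at h
    exact ⟨by rw [List.length_cons]; omega, mem_columnsLE.2 ⟨hv, h.2⟩⟩

theorem partitionFunction_fullColumn (n : ℕ) :
    partitionFunction (fullColumn n) (fullColumn n) = 1 := by
  have : (finite_staircases (fullColumn n) (fullColumn n)).toFinset = {[fullColumn n]} := by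
    ext t
    rw [Set.Finite.mem_toFinset, Finset.mem_singleton]
    constructor
    · intro ht
      have h1 := (mem_staircases_fullColumn ht).1
      rw [length_fullColumn] at h1
      obtain ⟨a, rfl⟩ := List.length_eq_one_iff.1 (show t.length = 1 by omega)
      have := ht.2.1
      simpa using this
    · rintro rfl
      refine ⟨⟨?_, List.isChain_singleton _⟩, rfl, rfl⟩
      simpa using (mem_columnsLE.1 (fullColumn_mem_columnsLE n)).1
  rw [partitionFunction, this, Finset.sum_singleton]
  simp [weight]

theorem weight_append_singleton {t : List (List ℕ)} {v u : List ℕ} {r : ℕ}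
    (ht : t.length = r + 1) (hv : t.getLast? = some v) :
    weight (t ++ [u]) = columnWeight (x (r + 1)) v u * weight t := by
  have hv' : t.getD r [] = v := by
    rw [List.getLast?_eq_getElem?, ht] at hv
    rw [List.getD_eq_getElem?_getD, ← Nat.add_sub_cancel (n := r) (m := 1), hv]
    rfl
  rw [weight, weight, List.length_append, ht, List.length_singleton, Nat.add_sub_cancel,
    Nat.add_sub_cancel, Finset.prod_range_succ, mul_comm]
  congr 1
  · rw [List.getD_append _ _ _ _ (by omega), hv', List.getD_append_right _ _ _ _ (by omega), ht]
    simp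
  · refine Finset.prod_congr rfl fun i hi => ?_
    have := Finset.mem_range.1 hi
    rw [List.getD_append _ _ _ _ (by omega), List.getD_append _ _ _ _ (by omega)]

theorem append_singleton_mem_staircases {n : ℕ} {u : List ℕ} (hu : IsColumn u) {v : List ℕ}
    (hvu : Adjacent v u) {t : List (List ℕ)} (ht : t ∈ staircases (fullColumn n) v) :
    t ++ [u] ∈ staircases (fullColumn n) u := by
  obtain ⟨⟨h1, h2⟩, h3, h4⟩ := ht
  refine ⟨⟨?_, ?_⟩, ?_, by simp⟩
  · intro c hc
    rcases List.mem_append.1 hc with hc | hc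
    · exact h1 c hc
    · rw [List.mem_singleton.1 hc]
      exact hu
  · rw [List.isChain_append]
    refine ⟨h2, List.isChain_singleton _, ?_⟩
    simpa [h4] using hvu
  · rw [List.head?_append, h3]
    rfl

theorem exists_of_mem_staircases {n : ℕ} {u : List ℕ} (hlen : u.length < n)
    {t : List (List ℕ)} (ht : t ∈ staircases (fullColumn n) u) :
    ∃ v s, Adjacent v u ∧ s ∈ staircases (fullColumn n) v ∧ t = s ++ [u] := by
  have hl := (mem_staircases_fullColumn ht).1
  obtain ⟨⟨h1, h2⟩, h3, h4⟩ := ht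
  obtain ⟨s, rfl⟩ := List.getLast?_eq_some_iff.1 h4
  rw [List.isChain_append] at h2
  rw [List.length_append, List.length_singleton] at hl
  obtain ⟨v, hv⟩ : ∃ v, s.getLast? = some v := by
    cases h : s.getLast? with
    | some v => exact ⟨v, rfl⟩
    | none =>
      rw [List.getLast?_eq_none_iff] at h
      subst h
      simp at hl
      omega
  refine ⟨v, s, h2.2.2 v hv u (by simp), ⟨⟨fun c hc => h1 c (by simp [hc]), h2.1⟩, ?_, hv⟩, rfl⟩
  have hs : s ≠ [] := by
    rintro rfl
    simp at hv
  rwa [List.head?_append_of_ne_nil _ hs] at h3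

/-- Deleting the last column is a bijection onto pairs of a left neighbour `v` of `u` and a
staircase ending in `v`; the deleted column carries `x_{r+1}`. -/
theorem partitionFunction_eq_sum {n r : ℕ} {u : List ℕ} (hu : IsColumn u)
    (hlen : u.length + (r + 1) = n) :
    partitionFunction (fullColumn n) u = ∑ v ∈ columnsLE n,
      adjWeight (x (r + 1)) v u * partitionFunction (fullColumn n) v := by
  classical
  have h1 : ∀ v ∈ columnsLE n, adjWeight (x (r + 1)) v u * partitionFunction (fullColumn n) v =
      if Adjacent v u then ∑ t ∈ (finite_staircases (fullColumn n) v).toFinset,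
        columnWeight (x (r + 1)) v u * weight t else 0 := by
    intro v _
    unfold adjWeight
    split_ifs
    · rw [partitionFunction, Finset.mul_sum]
    · rw [zero_mul]
  rw [Finset.sum_congr rfl h1, ← Finset.sum_filter, Finset.sum_sigma', partitionFunction]
  symm
  refine Finset.sum_bij (fun p _ => p.2 ++ [u]) ?_ ?_ ?_ ?_
  · rintro ⟨v, t⟩ h
    simp only [Finset.mem_sigma, Finset.mem_filter, Set.Finite.mem_toFinset] at h ⊢
    exact append_singleton_mem_staircases hu h.1.2 h.2
  · rintro ⟨v, t⟩ h ⟨v', t'⟩ h' he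
    simp only [Finset.mem_sigma, Finset.mem_filter, Set.Finite.mem_toFinset] at h h' he
    obtain rfl := List.append_cancel_right he
    obtain rfl : v = v' := Option.some.inj (h.2.2.2.symm.trans h'.2.2.2)
    rfl
  · intro t ht
    rw [Set.Finite.mem_toFinset] at ht
    obtain ⟨v, s, hvu, hs, rfl⟩ := exists_of_mem_staircases (by omega) ht
    refine ⟨⟨v, s⟩, ?_, rfl⟩
    simp only [Finset.mem_sigma, Finset.mem_filter, Set.Finite.mem_toFinset]
    exact ⟨⟨(mem_staircases_fullColumn hs).2, hvu⟩, hs⟩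
  · rintro ⟨v, t⟩ h
    simp only [Finset.mem_sigma, Finset.mem_filter, Set.Finite.mem_toFinset] at h ⊢
    have h2 := (mem_staircases_fullColumn h.2).1
    have h3 := h.1.2.1
    exact (weight_append_singleton (by omega) h.2.2.2).symm

/-! ### The determinantal formula for the partition function -/

theorem x_injective : Function.Injective x :=
  (IsFractionRing.injective Poly RatFun).comp px_injective

theorem x_ne_zero (i : ℕ) : x i ≠ 0 := by
  rw [x, Ne, FaithfulSMul.algebraMap_eq_zero_iff]
  exact MvPolynomial.X_ne_zero _

theorem x_ne_y (i j : ℕ) : x i ≠ y j := fun h => by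
  have := MvPolynomial.X_injective (IsFractionRing.injective Poly RatFun h)
  exact absurd this (by simp)

theorem ratPow_x_ne_zero (i s : ℕ) : ratPow s (x i) ≠ 0 := by
  refine Finset.prod_ne_zero_iff.2 fun b _ => sub_ne_zero.2 fun h => x_ne_y i b ?_
  rwa [div_eq_one_iff_eq (y_ne_zero b)] at h

/-- `∏_{i < j ≤ r} (x_i - x_j)`. -/
def vandermondeProd (r : ℕ) : RatFun :=
  ∏ i : Fin r, ∏ j ∈ Finset.Ioi i, (x (r - j) - x (r - i))

theorem vandermondeProd_ne_zero (r : ℕ) : vandermondeProd r ≠ 0 :=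
  Finset.prod_ne_zero_iff.2 fun i _ => Finset.prod_ne_zero_iff.2 fun j hj =>
    sub_ne_zero.2 (x_injective.ne (by
      have : i < j := Finset.mem_Ioi.1 hj
      omega))

theorem vandermondeProd_succ (r : ℕ) :
    vandermondeProd (r + 1) = (∏ j : Fin r, (x (r - j) - x (r + 1))) * vandermondeProd r := by
  rw [vandermondeProd, Fin.prod_univ_succ, Fin.prod_Ioi_zero, vandermondeProd]
  congr 1
  · refine Finset.prod_congr rfl fun j _ => ?_
    simp
  · refine Finset.prod_congr rfl fun i _ => ?_
    rw [Fin.prod_Ioi_succ]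
    refine Finset.prod_congr rfl fun j _ => ?_
    simp

theorem monom_eq_prod_range (z : ℕ → RatFun) (c : List ℕ) :
    monom z c = ∏ k ∈ Finset.range c.length, z (k + 1) ^ c.getD k 0 := by
  rw [monom, ← Fin.prod_univ_eq_prod_range (fun k => z (k + 1) ^ c.getD k 0)]
  refine Finset.prod_congr rfl fun k _ => ?_
  rw [List.getD_eq_getElem _ _ k.2, List.get_eq_getElem]

theorem monom_x_rho (r : ℕ) : monom x (rho r) = ∏ k ∈ Finset.range r, x (k + 1) ^ (r - 1 - k) := by
  rw [monom_eq_prod_range, rho, List.length_reverse, List.length_range]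
  refine Finset.prod_congr rfl fun k hk => ?_
  have hk' : k < (List.range r).reverse.length := by simpa using hk
  rw [List.getD_eq_getElem _ _ hk']
  simp

theorem monom_x_rho_succ (r : ℕ) :
    monom x (rho (r + 1)) = monom x (rho r) * ∏ j : Fin r, x (r - j) := by
  have h : ∏ j : Fin r, x (r - j) = ∏ k ∈ Finset.range r, x (k + 1) := by
    rw [← Finset.prod_range_reflect, ← Fin.prod_univ_eq_prod_range
      (fun k => x (r - 1 - k + 1))]
    refine Finset.prod_congr rfl fun j _ => ?_
    congr 1
    omega
  rw [h, monom_x_rho, monom_x_rho, Finset.prod_range_succ, ← Finset.prod_mul_distrib]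
  simp only [Nat.add_sub_cancel, Nat.sub_self, pow_zero, mul_one]
  refine Finset.prod_congr rfl fun k hk => ?_
  have := Finset.mem_range.1 hk
  rw [← pow_succ]
  congr 1
  omega

theorem monom_x_ne_zero (c : List ℕ) : monom x c ≠ 0 :=
  Finset.prod_ne_zero_iff.2 fun _ _ => pow_ne_zero _ (x_ne_zero _)

/-- In the induction, the factors `w_j / (w_j - z)` of the transfer, at `w_j = x_{r-j}` and `z =
x_{r+1}`, are the ratio of the new factors of `x^ρ` to those of the Vandermonde product. -/
theorem partitionFunction_mul_vandermondeProd {n r : ℕ} {u : List ℕ} (hu : u ∈ columnsLE n)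
    (hlen : u.length + r = n) :
    partitionFunction (fullColumn n) u * vandermondeProd r = monom x (rho r) *
      (Matrix.of fun i j : Fin r => ratPow ((complement n u).getD i 0) (x (r - j))).det := by
  induction r generalizing u with
  | zero =>
    rw [eq_fullColumn hu (by omega), partitionFunction_fullColumn]
    simp [vandermondeProd, monom_x_rho]
  | succ r ih =>
    have hw : ∀ j : Fin r, x (r - j) ≠ x (r + 1) := fun j => x_injective.ne (by omega)
    have h1 := sum_adjWeight_mul_det (w := fun j : Fin r => x (r - j)) hu hlen
      (ratPow_x_ne_zero (r + 1)) hw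
    -- The variables are listed in decreasing order of index so that the new one, `x_{r+1}`, comes
    -- first.
    have hcons : ∀ j : Fin (r + 1),
        (Fin.cons (x (r + 1)) fun j : Fin r => x (r - j) : Fin (r + 1) → RatFun) j =
          x (r + 1 - j) := by
      intro j
      refine Fin.cases ?_ (fun j => ?_) j
      · simp
      · simp
    simp only [hcons] at h1
    rw [Finset.prod_div_distrib] at h1
    have h2 : ∏ j : Fin r, (x (r - j) - x (r + 1)) ≠ 0 :=
      Finset.prod_ne_zero_iff.2 fun j _ => sub_ne_zero.2 (hw j)
    rw [div_mul_eq_mul_div, eq_div_iff h2] at h1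
    have h3 : (∑ v ∈ columnsLE n, adjWeight (x (r + 1)) v u *
        partitionFunction (fullColumn n) v) * vandermondeProd r =
        monom x (rho r) * ∑ v ∈ columnsLE n, adjWeight (x (r + 1)) v u *
          (Matrix.of fun i j : Fin r =>
            ratPow ((complement n v).getD i 0) (x (r - j))).det := by
      rw [Finset.sum_mul, Finset.mul_sum]
      refine Finset.sum_congr rfl fun v hv => ?_
      by_cases hvl : v.length = u.length + 1
      · rw [mul_assoc, ih hv (by omega), mul_left_comm]
      · rw [adjWeight_of_length_ne hvl, zero_mul, zero_mul, zero_mul, mul_zero]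
    rw [monom_x_rho_succ, mul_assoc, ← h1, vandermondeProd_succ,
      partitionFunction_eq_sum (mem_columnsLE.1 hu).1 hlen, mul_left_comm, h3]
    ring

/-! ### The comparison with double Schubert polynomials -/

theorem val_grassmannian_add_one {n : ℕ} {u : List ℕ} (hu : IsColumn u) (hn : ∀ a ∈ u, a ≤ n)
    (k : Fin n) : (grassmannian hu hn k : ℕ) + 1 = (complement n u ++ u.reverse).getD k 0 := by
  have hp := complement_append_perm hu hn
  have hk : (k : ℕ) < (complement n u ++ u.reverse).length := by
    rw [hp.length_eq, List.length_range']
    exact k.2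
  have h1 := (List.mem_range'_1.1 (hp.mem_iff.1 (List.getElem_mem hk))).1
  rw [List.getD_eq_getElem _ _ hk]
  change (complement n u ++ u.reverse)[(k : ℕ)] - 1 + 1 = _
  omega

theorem complement_pairwise (n : ℕ) (u : List ℕ) : (complement n u).Pairwise (· < ·) :=
  List.Pairwise.filter _ List.pairwise_lt_range'

theorem getD_lt_getD_of_pairwise {S : List ℕ} (hS : S.Pairwise (· < ·)) {i j : ℕ} (hij : i < j)
    (hj : j < S.length) : S.getD i 0 < S.getD j 0 := by
  rw [List.getD_eq_getElem _ _ (hij.trans hj), List.getD_eq_getElem _ _ hj]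
  exact List.pairwise_iff_getElem.1 hS _ _ _ _ hij

theorem grassmannian_lt_of_lt {n r : ℕ} {u : List ℕ} (hu : IsColumn u) (hn : ∀ a ∈ u, a ≤ n)
    (hlen : u.length + r = n) (i j : Fin n) (hij : i < j) (hj : (j : ℕ) < r) :
    grassmannian hu hn i < grassmannian hu hn j := by
  have hl := length_complement hu hn
  have hij' : (i : ℕ) < j := hij
  have h := getD_lt_getD_of_pairwise (complement_pairwise n u) hij' (by omega)
  have hi := val_grassmannian_add_one hu hn i
  have hj := val_grassmannian_add_one hu hn j
  rw [List.getD_append _ _ _ _ (by omega)] at hi hj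
  rw [Fin.lt_def]
  omega

theorem grassmannian_lt_of_ge {n r : ℕ} {u : List ℕ} (hu : IsColumn u) (hn : ∀ a ∈ u, a ≤ n)
    (hlen : u.length + r = n) (i j : Fin n) (hi : r ≤ (i : ℕ)) (hij : i < j) :
    grassmannian hu hn i < grassmannian hu hn j := by
  have hl := length_complement hu hn
  have hij' : (i : ℕ) < j := hij
  have hr : (complement n u).length = r := by omega
  have h := getD_lt_getD_of_pairwise (S := u.reverse) (i := i - r) (j := j - r)
    (List.pairwise_reverse.2 hu.1) (by omega) (by rw [List.length_reverse]; omega)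
  have hi := val_grassmannian_add_one hu hn i
  have hj := val_grassmannian_add_one hu hn j
  rw [List.getD_append_right _ _ _ _ (by omega), hr] at hi hj
  rw [Fin.lt_def]
  omega

theorem ratPow_succ_x (t i : ℕ) : ratPow (t + 1) (x i) =
    (∏ b ∈ Finset.Ico 1 (t + 1), y b)⁻¹ * algebraMap Poly RatFun (shiftedPow i t) := by
  rw [shiftedPow, map_prod, ratPow, ← Finset.prod_inv_distrib]
  change _ = _ * ∏ b ∈ Finset.Ico 1 (t + 1), _
  rw [← Finset.prod_mul_distrib]
  refine Finset.prod_congr rfl fun b _ => ?_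
  have := y_ne_zero b
  rw [map_sub]
  change _ = _ * (x i - y b)
  field_simp

/-- Double counting: `y_b` occurs once for each `s` in `S` with `b < s`. -/
theorem prod_pow_countP {S : List ℕ} {M : ℕ} (hS : ∀ s ∈ S, s ≤ M) :
    ∏ b ∈ Finset.range M, y (b + 1) ^ (S.countP fun a => decide (b + 1 < a)) =
      (S.map fun s => ∏ b ∈ Finset.Ico 1 s, y b).prod := by
  induction S with
  | nil => simp
  | cons s S ih =>
    have hs := hS s (by simp)
    rw [List.map_cons, List.prod_cons, ← ih fun a ha => hS a (by simp [ha])]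
    simp only [List.countP_cons, pow_add, Finset.prod_mul_distrib]
    rw [mul_comm]
    congr 1
    simp only [decide_eq_true_eq, pow_ite, pow_one, pow_zero]
    rw [← Finset.prod_filter, Finset.prod_Ico_eq_prod_range]
    refine Finset.prod_congr ?_ fun b _ => by rw [add_comm]
    ext b
    simp only [Finset.mem_filter, Finset.mem_range]
    omega

theorem monom_y_levels (S : List ℕ) :
    monom y (levels S) = (S.map fun s => ∏ b ∈ Finset.Ico 1 s, y b).prod := by
  have hS : ∀ s ∈ S, s ≤ S.foldr max 0 := by
    intro s hs
    induction S with
    | nil => simp at hs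
    | cons a S ih =>
      rcases List.mem_cons.1 hs with rfl | hs
      · exact le_max_left _ _
      · exact (ih hs).trans (le_max_right _ _)
  rw [← prod_pow_countP hS, monom_eq_prod_range, levels, List.length_map, List.length_range']
  refine Finset.prod_congr rfl fun k hk => ?_
  have hk' := Finset.mem_range.1 hk
  rw [List.getD_eq_getElem _ _ (by simpa using hk')]
  simp only [List.getElem_map, List.getElem_range', one_mul, add_comm 1]

/-- Both sides satisfy a determinantal formula with the same Vandermonde factor, which is cancelled;
the determinants agree after the powers of `y` are extracted row by row. -/
theorem partitionFunction_eq_schubert {n r : ℕ} {u : List ℕ} (hu : IsColumn u)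
    (hlen : u.length + r = n) (hle : ∀ a ∈ u, a ≤ n) :
    partitionFunction (fullColumn n) u = monom x (rho r) *
      (monom y (levels (complement n u)))⁻¹ *
        algebraMap Poly RatFun (schubert (grassmannian hu hle)) := by
  have hr : r ≤ n := by omega
  have hl : (complement n u).length = r := by
    have := length_complement hu hle
    omega
  have h1 := partitionFunction_mul_vandermondeProd (mem_columnsLE.2 ⟨hu, hle⟩) hlen
  have h2 := congrArg (algebraMap Poly RatFun) (schubert_mul_prod hr _
    (grassmannian_lt_of_lt hu hle hlen) (grassmannian_lt_of_ge hu hle hlen))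
  rw [RingHom.map_det, map_mul, map_prod] at h2
  simp only [map_prod, map_sub] at h2
  change _ * vandermondeProd r = _ at h2
  have h3 : ∀ i : Fin r, (complement n u).getD i 0 =
      grassmannian hu hle (i.castLE hr) + 1 := by
    intro i
    rw [val_grassmannian_add_one, List.getD_append _ _ _ _ (by simp [hl])]
    rfl
  have h4 : (Matrix.of fun i j : Fin r => ratPow ((complement n u).getD i 0) (x (r - j))).det =
      (monom y (levels (complement n u)))⁻¹ * ((algebraMap Poly RatFun).mapMatrix
        (Matrix.of fun i j : Fin r =>
          shiftedPow (r - j) (grassmannian hu hle (i.castLE hr)))).det := by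
    rw [monom_y_levels, map_eq_ofFn_getD _ hl, List.prod_ofFn, ← Finset.prod_inv_distrib,
      ← Matrix.det_mul_column]
    congr 1
    ext i j
    simp only [Matrix.of_apply, RingHom.mapMatrix_apply, Matrix.map_apply, h3, ratPow_succ_x]
  rw [h4, ← h2] at h1
  apply mul_right_cancel₀ (vandermondeProd_ne_zero r)
  rw [h1]
  ring

/-! ### Symmetry of rational functions in `x₁, …, x_r`. -/

theorem permXRat_algebraMap (π : Equiv.Perm ℕ) (f : Poly) :
    permXRat π (algebraMap Poly RatFun f) = algebraMap Poly RatFun (permX π f) :=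
  IsFractionRing.ringEquivOfRingEquiv_algebraMap _ _

theorem permXRat_monom_y (π : Equiv.Perm ℕ) (c : List ℕ) :
    permXRat π (monom y c) = monom y c := by
  simp only [monom, map_prod, map_pow]
  refine Finset.prod_congr rfl fun k _ => ?_
  rw [y, permXRat_algebraMap, permX_py]

theorem exists_indexPerm_eq {r : ℕ} (π : Equiv.Perm ℕ) (hπ : ∀ i, π i ≠ i → 1 ≤ i ∧ i ≤ r) :
    ∃ g : Equiv.Perm (Fin r), indexPerm g = π := by
  -- If `π` moves `i`, it also moves `π i`, so both lie in `{1, …, r}`.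
  have hp : ∀ i, (1 ≤ π i ∧ π i ≤ r) ↔ (1 ≤ i ∧ i ≤ r) := by
    intro i
    by_cases h : π i = i
    · rw [h]
    · exact iff_of_true (hπ _ fun h' => h (π.injective h')) (hπ i h)
  refine ⟨(indexEquiv r).permCongr.symm (π.subtypePerm hp), ?_⟩
  ext k
  by_cases hk : 1 ≤ k ∧ k ≤ r
  · rw [indexPerm, Equiv.Perm.extendDomain_apply_subtype _ (indexEquiv r) hk]
    simp
  · rw [indexPerm, Equiv.Perm.extendDomain_apply_not_subtype _ (indexEquiv r) hk]
    by_contra h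
    exact hk (hπ k (Ne.symm h))

end Staircase

end

theorem mainTheorem1 (n r : ℕ) (hn : 0 < n) (u : List ℕ) (hu : Staircase.IsColumn u)
    (hlen : u.length + r = n) (hle : ∀ a ∈ u, a ≤ n) :
    Staircase.partitionFunction (Staircase.fullColumn n) u =
        Staircase.monom Staircase.x (Staircase.rho r) *
          (Staircase.monom Staircase.y (Staircase.levels (Staircase.complement n u)))⁻¹ *
          algebraMap Staircase.Poly Staircase.RatFun
            (Staircase.schubert (Staircase.grassmannian hu hle)) ∧
      ∀ π : Equiv.Perm ℕ, (∀ i, π i ≠ i → 1 ≤ i ∧ i ≤ r) →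
        Staircase.permXRat π
            (Staircase.partitionFunction (Staircase.fullColumn n) u *
              (Staircase.monom Staircase.x (Staircase.rho r))⁻¹) =
          Staircase.partitionFunction (Staircase.fullColumn n) u *
            (Staircase.monom Staircase.x (Staircase.rho r))⁻¹ := by
  have hF := Staircase.partitionFunction_eq_schubert hu hlen hle
  refine ⟨hF, fun π hπ => ?_⟩
  obtain ⟨g, rfl⟩ := Staircase.exists_indexPerm_eq π hπ
  have h1 : Staircase.partitionFunction (Staircase.fullColumn n) u *
      (Staircase.monom Staircase.x (Staircase.rho r))⁻¹ =
      (Staircase.monom Staircase.y (Staircase.levels (Staircase.complement n u)))⁻¹ *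
        algebraMap Staircase.Poly Staircase.RatFun
          (Staircase.schubert (Staircase.grassmannian hu hle)) := by
    have := Staircase.monom_x_ne_zero (Staircase.rho r)
    rw [hF]
    field_simp
  rw [h1, map_mul, map_inv₀, Staircase.permXRat_monom_y, Staircase.permXRat_algebraMap,
    Staircase.permX_schubert (by omega) _ (Staircase.grassmannian_lt_of_lt hu hle hlen)]
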